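/- **Setting.** For $i=1,2$ let $T_i(z)=C_i(zI-A_i)^{-1}B_i+D_i$ with real state-space matrices $A_i\in\mathbb R^{n_i\times n_i}$, $B_i\in\mathbb R^{n_i\times1}$, $C_i\in\mathbb R^{1\times n_i}$, $D_i\in\mathbb R$ ($n_i\ge 0$), stable in the sense that all eigenvalues of $A_i$ lie in the open unit disc. For $N\ge 0$ and $\alpha=(\alpha_0,\dots,\alpha_N)\in\mathbb R^{N+1}$ let $Q_\alpha(z)=\sum_{i=0}^N\alpha_iz^{-i}$, let $A_q\in\mathbb R^{N\times N}$ be the matrix with ones on the superdiagonal and zeros elsewhere, $B_q=(0,\dots,0,1)^\top\in\mathbb R^{N\times 1}$, $\alpha_{N:1}=[\alpha_N,\dots,\alpha_1]$, and $$A=\begin{bmatrix}A_1&0&0\\0&A_2&0\\0&B_qC_2&A_q\end{bmatrix},\quad B=\begin{bmatrix}B_1\\B_2\\B_qD_2\end{bmatrix},\quad C(\alpha)=[\,C_1,\ \alpha_0C_2,\ \alpha_{N:1}\,],\quad D(\alpha_0)=D_1+\alpha_0D_2,$$ which is a realization of $T_\alpha=T_1+Q_\alpha T_2$. Assume that $(A,B)$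 is controllable. Let $0\le\omega_1<\omega_2\le\pi$, $\Omega=[\omega_1,\omega_2]$, $\omega_0=\frac{\omega_1+\omega_2}2$, $r=\frac{\omega_2-\omega_1}2$, and $V_\Omega(T_\alpha)=\max_{\omega\in\Omega}|T_\alpha(e^{j\omega})|$. For real symmetric $X,Y$ of the size of $A$, and $g\in\mathbb R$, put $$\mathcal M(X,Y,g,\alpha)=\begin{bmatrix}M_1&M_2&C(\alpha)^\top\\ \overline M_2^{\,\top}&M_3&D(\alpha_0)\\ C(\alpha)&D(\alpha_0)&-1\end{bmatrix},$$ $$M_1=A^\top XA+YAe^{-j\omega_0}+A^\top Ye^{j\omega_0}-X-2Y\cos r,$$ $$M_2=A^\top XB+YBe^{-j\omega_0},\qquad \overline M_2=A^\top XB+YBe^{j\omega_0},\qquad M_3=B^\top XB-g.$$ **Theorem.** 1. For every $\alpha$ the maximum defining $V_\Omega(T_\alpha)$ is attained. For every $\alpha$ and every $\gamma\ge0$, $V_\Omega(T_\alpha)\le\gamma$ holds if and only if there are real symmetric matrices $X$ and $Y\succeq0$ with $\mathcal M(X,Y,\gamma^2,\alpha)\preceq0$. 2. For every $\alpha$ and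 every $\gamma\ge0$, $V_\Omega(T_\alpha)<\gamma$ holds if and only if there are real symmetric matrices $X$ and $Y\succ0$ with $\mathcal M(X,Y,\gamma^2,\alpha)\prec0$. 3. $\mathcal M$ is a (real-)affine function of $(X,Y,g,\alpha)$, where $g=\gamma^2$. 4. Consequently the finite-frequency design problem $\min_{\alpha}V_\Omega(T_1+Q_\alpha T_2)$ is a semidefinite program: $\alpha$ minimizes $V_\Omega(T_\alpha)$ and $g=V_\Omega(T_\alpha)^2$ if and only if $(g,\alpha)$, together with some $X,Y$, is an optimal solution of $$\text{minimize } g\quad\text{subject to}\quad X=X^\top,\ Y\succeq0,\ \mathcal M(X,Y,g,\alpha)\preceq0 .$$ (The choices $(T_1,T_2)=(P,-1)$ and $(T_1,T_2)=(-1,P)$ give FIR approximation and FIR inversion of $P$ over the band $\Omega$.) -/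

import Mathlib

open scoped Matrix ComplexOrder

noncomputable section

/-- A real single-input single-output discrete-time state-space model
`x[k+1] = A x[k] + B u[k]`, `y[k] = C x[k] + D u[k]` with state indexed by `ι`. -/
structure StateSpace (ι : Type) where
  A : Matrix ι ι ℝ
  B : Matrix ι Unit ℝ
  C : Matrix Unit ι ℝ
  D : ℝ

/-- Entrywise inclusion of real matrices into complex matrices. -/
def cplx {m n : Type} (M : Matrix m n ℝ) : Matrix m n ℂ := M.map (fun x : ℝ => (x : ℂ))

namespace StateSpace

/-- The transfer function `C (z I - A)⁻¹ B + D`. -/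
def transfer {ι : Type} [Fintype ι] [DecidableEq ι] (G : StateSpace ι) (z : ℂ) : ℂ :=
  (cplx G.C * (z • (1 : Matrix ι ι ℂ) - cplx G.A)⁻¹ * cplx G.B) () () + (G.D : ℂ)

/-- Stability: every complex eigenvalue of `A` lies in the open unit disc. -/
def IsStable {ι : Type} [Fintype ι] [DecidableEq ι] (G : StateSpace ι) : Prop :=
  ∀ μ ∈ spectrum ℂ (cplx G.A), ‖μ‖ < 1

end StateSpace

/-- Controllability of `(A, B)`: the vectors `B, A B, A² B, …` span the state space. -/
def IsControllable {ι : Type} [Fintype ι] [DecidableEq ι]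
    (A : Matrix ι ι ℝ) (B : Matrix ι Unit ℝ) : Prop :=
  Submodule.span ℝ (Set.range fun k : ℕ => fun i : ι => (A ^ k * B) i ()) = ⊤

/-- The FIR filter `Q(z) = ∑_{i=0}^N α_i z^{-i}`. -/
def firTransfer {N : ℕ} (α : Fin (N + 1) → ℝ) (z : ℂ) : ℂ :=
  ∑ i : Fin (N + 1), (α i : ℂ) * z⁻¹ ^ (i : ℕ)

/-- The `N × N` shift matrix, with ones on the superdiagonal. -/
def firA (N : ℕ) : Matrix (Fin N) (Fin N) ℝ :=
  Matrix.of fun i j => if (j : ℕ) = (i : ℕ) + 1 then 1 else 0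

/-- The last standard basis column. -/
def firB (N : ℕ) : Matrix (Fin N) Unit ℝ :=
  Matrix.of fun i _ => if (i : ℕ) + 1 = N then 1 else 0

/-- The row `[α_N, α_{N-1}, …, α_1]`. -/
def firC {N : ℕ} (α : Fin (N + 1) → ℝ) : Matrix Unit (Fin N) ℝ :=
  Matrix.of fun _ j => α ⟨N - (j : ℕ), by omega⟩

/-- State matrix of the augmented realization of `T₁ + Q T₂`; it does not depend on `α`. -/
def augA {n₁ n₂ : ℕ} (N : ℕ) (G₁ : StateSpace (Fin n₁)) (G₂ : StateSpace (Fin n₂)) :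
    Matrix (Fin n₁ ⊕ (Fin n₂ ⊕ Fin N)) (Fin n₁ ⊕ (Fin n₂ ⊕ Fin N)) ℝ :=
  Matrix.fromBlocks G₁.A 0 0 (Matrix.fromBlocks G₂.A 0 (firB N * G₂.C) (firA N))

/-- Input matrix of the augmented realization; it does not depend on `α`. -/
def augB {n₁ n₂ : ℕ} (N : ℕ) (G₁ : StateSpace (Fin n₁)) (G₂ : StateSpace (Fin n₂)) :
    Matrix (Fin n₁ ⊕ (Fin n₂ ⊕ Fin N)) Unit ℝ :=
  Matrix.fromRows G₁.B (Matrix.fromRows G₂.B (G₂.D • firB N))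

/-- The augmented realization of `T₁ + Q T₂`. -/
def augmented {n₁ n₂ N : ℕ} (G₁ : StateSpace (Fin n₁)) (G₂ : StateSpace (Fin n₂))
    (α : Fin (N + 1) → ℝ) : StateSpace (Fin n₁ ⊕ (Fin n₂ ⊕ Fin N)) where
  A := augA N G₁ G₂
  B := augB N G₁ G₂
  C := Matrix.fromCols G₁.C (Matrix.fromCols (α 0 • G₂.C) (firC α))
  D := G₁.D + α 0 * G₂.D

/-- `V_Ω(T) = max_{ω ∈ [ω₁, ω₂]} |T(e^{jω})|`, as a supremum. -/
def bandMax (ω₁ ω₂ : ℝ) (T : ℂ → ℂ) : ℝ :=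
  sSup ((fun ω : ℝ => ‖T (Complex.exp (ω * Complex.I))‖) '' Set.Icc ω₁ ω₂)

/-- `V_Ω(T₁ + Q T₂)`, where `Q` is the FIR filter with coefficients `α`. -/
def designGain {n₁ n₂ N : ℕ} (G₁ : StateSpace (Fin n₁)) (G₂ : StateSpace (Fin n₂))
    (ω₁ ω₂ : ℝ) (α : Fin (N + 1) → ℝ) : ℝ :=
  bandMax ω₁ ω₂ fun z => G₁.transfer z + firTransfer α z * G₂.transfer z

section GKYP

variable {ι : Type} [Fintype ι]

/-- `M₁(X, Y) = AᵀXA + YA e^{-jω₀} + AᵀY e^{jω₀} - X - 2 Y cos r`. -/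
def gkypM1 (A X Y : Matrix ι ι ℝ) (ω₀ r : ℝ) : Matrix ι ι ℂ :=
  cplx (Aᵀ * X * A) + Complex.exp (-(ω₀ * Complex.I)) • cplx (Y * A)
    + Complex.exp (ω₀ * Complex.I) • cplx (Aᵀ * Y) - cplx X - cplx ((2 * Real.cos r) • Y)

/-- `AᵀXB + YB e^{-jθ}`: this is `M₂(X, Y)` for `θ = ω₀`, and the conjugate `M̄₂(X, Y)`
for `θ = -ω₀`. -/
def gkypM2 (A : Matrix ι ι ℝ) (B : Matrix ι Unit ℝ) (X Y : Matrix ι ι ℝ) (θ : ℝ) :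
    Matrix ι Unit ℂ :=
  cplx (Aᵀ * X * B) + Complex.exp (-(θ * Complex.I)) • cplx (Y * B)

/-- `M₃(X, g) = BᵀXB - g`, where `g` stands for `γ²`. -/
def gkypM3 (B : Matrix ι Unit ℝ) (X : Matrix ι ι ℝ) (g : ℝ) : Matrix Unit Unit ℂ :=
  cplx (Bᵀ * X * B) - cplx (g • (1 : Matrix Unit Unit ℝ))

/-- The generalized KYP matrix
`[[M₁, M₂, Cᵀ], [M̄₂ᵀ, M₃, D], [C, D, -1]]` for the band `[ω₁, ω₂]`, with
`ω₀ = (ω₁ + ω₂) / 2` and `r = (ω₂ - ω₁) / 2`. -/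
def gkypMatrix (G : StateSpace ι) (ω₁ ω₂ : ℝ) (X Y : Matrix ι ι ℝ) (g : ℝ) :
    Matrix ((ι ⊕ Unit) ⊕ Unit) ((ι ⊕ Unit) ⊕ Unit) ℂ :=
  Matrix.fromBlocks
    (Matrix.fromBlocks
      (gkypM1 G.A X Y ((ω₁ + ω₂) / 2) ((ω₂ - ω₁) / 2))
      (gkypM2 G.A G.B X Y ((ω₁ + ω₂) / 2))
      (gkypM2 G.A G.B X Y (-((ω₁ + ω₂) / 2)))ᵀ
      (gkypM3 G.B X g))
    (Matrix.fromRows (cplx G.Cᵀ) (cplx (G.D • (1 : Matrix Unit Unit ℝ))))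
    (Matrix.fromCols (cplx G.C) (cplx (G.D • (1 : Matrix Unit Unit ℝ))))
    (-1)

end GKYP

/-- Feasibility of `(X, Y, g, α)` for the semidefinite program: `X` is symmetric, `Y ⪰ 0`, and
the generalized KYP matrix of the augmented realization is negative semidefinite. -/
def SDPFeasible {n₁ n₂ N : ℕ} (G₁ : StateSpace (Fin n₁)) (G₂ : StateSpace (Fin n₂))
    (ω₁ ω₂ : ℝ)
    (X Y : Matrix (Fin n₁ ⊕ (Fin n₂ ⊕ Fin N)) (Fin n₁ ⊕ (Fin n₂ ⊕ Fin N)) ℝ)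
    (g : ℝ) (α : Fin (N + 1) → ℝ) : Prop :=
  X.IsSymm ∧ Y.PosSemidef ∧ (-(gkypMatrix (augmented G₁ G₂ α) ω₁ ω₂ X Y g)).PosSemidef

end

/-! Sufficiency is evaluation on harmonic trajectories. If `z = e^{jω}`, `z x = A x + B u` and `y =
C x + D u`, the form of the KYP matrix at `(x, u, y)` equals `2 (cos (ω - ω₀) - cos r) x*Yx - g |u|²
+ |y|²` (`gkyp_form_trajectory`), and the first term is nonnegative on the band.

Necessity has to produce real multipliers. Controllability gives coordinates in which the state
equation is a shift: trajectories become `x = E (1, z, …, z^{n-1})`, `u = χ(z)`, with `χ` the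
characteristic polynomial of `A` (`exists_shift_coordinates`). Then `g |u|² - |y|²` is a real
symmetric form `Q` at `(1, z, …, zⁿ)`, hence a polynomial `p (cos ω)` of degree at most `n`,
nonnegative on the band. Lukács' theorem (`IntervalSOS.of_nonneg`) writes `p` as a sum of squares
times the weights `1`, `x - cos ω₂`, `cos ω₁ - x` and the product of the last two. Each summand has
an explicit certificate: a real form that represents it and is a band term with `Y ⪰ 0` plus a
positive semidefinite form (`bandCert_of_nonneg`). If `R` is the total certificate form, `Q - R`
vanishes on the unit circle, so it telescopes, and this supplies `X` (`exists_telescoping`). A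
congruence returns to the original coordinates.

For the strict version, multipliers at the level `V²` are perturbed by a Lyapunov matrix of the
stable `A`, and then by a small multiple of the identity in `Y` (`exists_strict_multipliers`). Hence
for fixed `α` the least feasible `g` is `V²`, from which the equivalence with the semidefinite
program follows. -/

/-! ### Lukács' theorem on polynomials nonnegative on an interval. -/

section IntervalPolynomials

open Polynomial

/-- The cone of polynomials that are visibly nonnegative on `[a, b]`, with all summands of degree
at most `n`. -/
inductive IntervalSOS (a b : ℝ) (n : ℕ) : ℝ[X] → Prop
  | sq (s : ℝ[X]) (hs : 2 * s.natDegree ≤ n) : IntervalSOS a b n (s ^ 2)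
  | left (s : ℝ[X]) (hs : 2 * s.natDegree + 1 ≤ n) : IntervalSOS a b n ((X - C a) * s ^ 2)
  | right (s : ℝ[X]) (hs : 2 * s.natDegree + 1 ≤ n) : IntervalSOS a b n ((C b - X) * s ^ 2)
  | both (s : ℝ[X]) (hs : 2 * s.natDegree + 2 ≤ n) :
      IntervalSOS a b n ((X - C a) * (C b - X) * s ^ 2)
  | add (p q : ℝ[X]) (hp : IntervalSOS a b n p) (hq : IntervalSOS a b n q) :
      IntervalSOS a b n (p + q)

namespace IntervalSOS

variable {a b : ℝ} {n : ℕ} {p : ℝ[X]}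

theorem natDegree_X_sub_C_mul_le (e : ℝ) (s : ℝ[X]) :
    ((X - C e) * s).natDegree ≤ s.natDegree + 1 :=
  natDegree_mul_le.trans (by rw [natDegree_X_sub_C]; omega)

theorem natDegree_C_sub_X_mul_le (e : ℝ) (s : ℝ[X]) :
    ((C e - X) * s).natDegree ≤ s.natDegree + 1 := by
  have : (C e - X) * s = -((X - C e) * s) := by ring
  rw [this, natDegree_neg]
  exact natDegree_X_sub_C_mul_le e s

/-- The four weights are closed under multiplication by `X - a`: a repeated factor is absorbed into
the square, and the degree grows by one. -/
theorem mul_left (h : IntervalSOS a b n p) : IntervalSOS a b (n + 1) ((X - C a) * p) := by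
  induction h with
  | sq s hs => exact left s (by omega)
  | left s hs =>
    have := sq (a := a) (b := b) (n := n + 1) ((X - C a) * s)
      (by have := natDegree_X_sub_C_mul_le a s; omega)
    convert this using 1; ring
  | right s hs =>
    have := both (a := a) (b := b) (n := n + 1) s (by omega)
    convert this using 1; ring
  | both s hs =>
    have := right (a := a) (b := b) (n := n + 1) ((X - C a) * s)
      (by have := natDegree_X_sub_C_mul_le a s; omega)
    convert this using 1; ring
  | add p q _ _ hp hq => rw [mul_add]; exact add _ _ hp hq

theorem mul_right (h : IntervalSOS a b n p) : IntervalSOS a b (n + 1) ((C b - X) * p) := by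
  induction h with
  | sq s hs => exact right s (by omega)
  | left s hs =>
    have := both (a := a) (b := b) (n := n + 1) s (by omega)
    convert this using 1; ring
  | right s hs =>
    have := sq (a := a) (b := b) (n := n + 1) ((C b - X) * s)
      (by have := natDegree_C_sub_X_mul_le b s; omega)
    convert this using 1; ring
  | both s hs =>
    have := left (a := a) (b := b) (n := n + 1) ((C b - X) * s)
      (by have := natDegree_C_sub_X_mul_le b s; omega)
    convert this using 1; ring
  | add p q _ _ hp hq => rw [mul_add]; exact add _ _ hp hq

theorem mul_sq (e : ℝ) (h : IntervalSOS a b n p) :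
    IntervalSOS a b (n + 2) ((X - C e) ^ 2 * p) := by
  induction h with
  | sq s hs =>
    have := sq (a := a) (b := b) (n := n + 2) ((X - C e) * s)
      (by have := natDegree_X_sub_C_mul_le e s; omega)
    convert this using 1; ring
  | left s hs =>
    have := left (a := a) (b := b) (n := n + 2) ((X - C e) * s)
      (by have := natDegree_X_sub_C_mul_le e s; omega)
    convert this using 1; ring
  | right s hs =>
    have := right (a := a) (b := b) (n := n + 2) ((X - C e) * s)
      (by have := natDegree_X_sub_C_mul_le e s; omega)
    convert this using 1; ring
  | both s hs =>
    have := both (a := a) (b := b) (n := n + 2) ((X - C e) * s)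
      (by have := natDegree_X_sub_C_mul_le e s; omega)
    convert this using 1; ring
  | add p q _ _ hp hq => rw [mul_add]; exact add _ _ hp hq

theorem const (c : ℝ) (hc : 0 ≤ c) : IntervalSOS a b n (C c) := by
  have := sq (a := a) (b := b) (n := n) (C √c) (by simp)
  rwa [← C_pow, Real.sq_sqrt hc] at this

/-- After division by a linear factor the sign of the quotient at the root is unknown. It is
recovered by continuity, since `[a, b]` without one point is dense in `[a, b]`. -/
theorem eval_nonneg_of_dense (hab : a < b) (e : ℝ)
    (h : ∀ x ∈ Set.Icc a b, x ≠ e → 0 ≤ p.eval x) : ∀ x ∈ Set.Icc a b, 0 ≤ p.eval x := by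
  have hcl : Set.Icc a b ⊆ closure (Set.Ioo a b \ {e}) := by
    have hd : Dense ({e}ᶜ : Set ℝ) := dense_compl_singleton e
    have : closure (Set.Ioo a b) ⊆ closure (Set.Ioo a b ∩ {e}ᶜ) :=
      closure_minimal (hd.open_subset_closure_inter isOpen_Ioo) isClosed_closure
    rwa [closure_Ioo hab.ne] at this
  intro x hx
  have hclosed : IsClosed {x : ℝ | 0 ≤ p.eval x} := isClosed_le continuous_const p.continuous
  have : closure (Set.Ioo a b \ {e}) ⊆ {x : ℝ | 0 ≤ p.eval x} :=
    closure_minimal (fun y hy => h y (Set.Ioo_subset_Icc_self hy.1) hy.2) hclosed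
  exact this (hcl hx)

/-- Lukács: a polynomial of degree at most `n` that is nonnegative on `[a, b]` lies in the cone
`IntervalSOS a b n`. -/
theorem of_nonneg (hab : a < b) : ∀ (n : ℕ) (p : ℝ[X]), p.natDegree ≤ n →
    (∀ x ∈ Set.Icc a b, 0 ≤ p.eval x) → IntervalSOS a b n p := by
  intro n
  induction n using Nat.strong_induction_on with
  | _ n ih =>
  intro p hdeg hp
  obtain ⟨e, he, hmin⟩ := isCompact_Icc.exists_isMinOn (Set.nonempty_Icc.2 hab.le)
    p.continuous.continuousOn
  rcases Nat.eq_zero_or_pos n with hn | hn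
  · subst hn
    rw [eq_C_of_natDegree_le_zero hdeg] at hp ⊢
    exact const _ (by simpa using hp a (Set.left_mem_Icc.2 hab.le))
  -- Subtracting the minimum forces a root `e` in `[a, b]`. A root at an endpoint splits off one
  -- weight; an interior root is double and splits off a square.
  suffices h : IntervalSOS a b n (p - C (p.eval e)) by
    have := add _ _ h (const (p.eval e) (hp e he))
    simpa using this
  have hroot : (p - C (p.eval e)).IsRoot e := by simp
  have hnn : ∀ x ∈ Set.Icc a b, 0 ≤ (p - C (p.eval e)).eval x := by
    intro x hx
    have := hmin hx
    simpa using this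
  have hdeg' : (p - C (p.eval e)).natDegree ≤ n := by rwa [natDegree_sub_C]
  generalize p - C (p.eval e) = q at hroot hnn hdeg'
  obtain ⟨s, hs⟩ := dvd_iff_isRoot.2 hroot
  have hsdeg : s.natDegree ≤ n - 1 := by
    by_cases h0 : s = 0
    · simp [h0]
    · rw [hs, natDegree_mul (X_sub_C_ne_zero e) h0, natDegree_X_sub_C] at hdeg'
      omega
  have hse : ∀ x, q.eval x = (x - e) * s.eval x := by intro x; rw [hs]; simp
  rcases eq_or_lt_of_le he.1 with hae | hae
  · subst hae
    have := ih (n - 1) (by omega) s hsdeg (eval_nonneg_of_dense hab a fun x hx hxa => by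
      have h1 := hnn x hx
      rw [hse] at h1
      exact nonneg_of_mul_nonneg_right h1 (sub_pos.2 (lt_of_le_of_ne hx.1 (Ne.symm hxa))))
    have := this.mul_left
    rwa [← hs, Nat.sub_add_cancel hn] at this
  rcases eq_or_lt_of_le he.2 with heb | heb
  · subst heb
    have := ih (n - 1) (by omega) (-s) (by rwa [natDegree_neg])
      (eval_nonneg_of_dense hab e fun x hx hxa => by
        have h1 := hnn x hx
        rw [hse] at h1
        rw [eval_neg]
        have h2 : 0 < e - x := sub_pos.2 (lt_of_le_of_ne hx.2 hxa)
        refine nonneg_of_mul_nonneg_right (?_ : 0 ≤ (e - x) * _) h2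
        linarith)
    have := this.mul_right
    rw [Nat.sub_add_cancel hn] at this
    rw [hs]
    convert this using 1; ring
  -- If `s e ≠ 0`, then `q = (X - e) s` would change sign at the interior point `e`.
  · have hs0 : s.IsRoot e := by
      by_contra hne
      have hne' : s.eval e ≠ 0 := hne
      have hcont : ContinuousAt (fun x => s.eval x) e := s.continuous.continuousAt
      rcases lt_or_gt_of_ne hne' with hlt | hgt
      · have h1 : ∀ᶠ x in nhds e, s.eval x < 0 := hcont.eventually_lt_const hlt
        have h2 : ∀ᶠ x in nhds e, x < b := eventually_lt_nhds heb
        obtain ⟨x, ⟨hx1, hx2⟩, hx3⟩ :=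
          (((h1.and h2).filter_mono nhdsWithin_le_nhds).and
            (self_mem_nhdsWithin (s := Set.Ioi e))).exists
        have := hnn x ⟨(hae.trans hx3).le, hx2.le⟩
        rw [hse] at this
        have hx3' : e < x := hx3
        nlinarith
      · have h1 : ∀ᶠ x in nhds e, 0 < s.eval x := hcont.eventually_const_lt hgt
        have h2 : ∀ᶠ x in nhds e, a < x := eventually_gt_nhds hae
        obtain ⟨x, ⟨hx1, hx2⟩, hx3⟩ :=
          (((h1.and h2).filter_mono nhdsWithin_le_nhds).and
            (self_mem_nhdsWithin (s := Set.Iio e))).exists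
        have hx3' : x < e := hx3
        have := hnn x ⟨hx2.le, (hx3'.trans heb).le⟩
        rw [hse] at this
        nlinarith
    obtain ⟨t, ht⟩ := dvd_iff_isRoot.2 hs0
    by_cases ht0 : t = 0
    · have hq0 : q = C 0 := by rw [hs, ht, ht0]; simp
      rw [hq0]; exact const 0 le_rfl
    rw [ht, natDegree_mul (X_sub_C_ne_zero e) ht0, natDegree_X_sub_C] at hsdeg
    have := ih (n - 2) (by omega) t (by omega) (eval_nonneg_of_dense hab e fun x hx hxa => by
      have h1 := hnn x hx
      rw [hse, ht, eval_mul, ← mul_assoc] at h1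
      simp only [eval_sub, eval_X, eval_C] at h1
      exact nonneg_of_mul_nonneg_right h1 (mul_self_pos.2 (sub_ne_zero.2 hxa)))
    have := this.mul_sq e
    rw [Nat.sub_add_cancel (by omega)] at this
    rw [hs, ht]
    convert this using 1; ring

end IntervalSOS

end IntervalPolynomials

/-! ### Real matrices over the complex numbers, and the band term. -/

section Cplx

variable {l m n : Type}

theorem cplx_mul [Fintype m] (M : Matrix l m ℝ) (N : Matrix m n ℝ) :
    cplx (M * N) = cplx M * cplx N := by
  ext i j; simp [cplx, Matrix.mul_apply]

theorem cplx_add (M N : Matrix m n ℝ) : cplx (M + N) = cplx M + cplx N := by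
  ext i j; simp [cplx]

theorem cplx_sub (M N : Matrix m n ℝ) : cplx (M - N) = cplx M - cplx N := by
  ext i j; simp [cplx]

theorem cplx_smul (c : ℝ) (M : Matrix m n ℝ) : cplx (c • M) = (c : ℂ) • cplx M := by
  ext i j; simp [cplx]

theorem cplx_zero : cplx (0 : Matrix m n ℝ) = 0 := by
  ext i j; simp [cplx]

theorem cplx_one [DecidableEq m] : cplx (1 : Matrix m m ℝ) = 1 := by
  ext i j; by_cases h : i = j <;> simp [cplx, Matrix.one_apply, h]

theorem cplx_transpose (M : Matrix m n ℝ) : cplx Mᵀ = (cplx M)ᵀ := rfl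

theorem conjTranspose_cplx (M : Matrix m n ℝ) : (cplx M)ᴴ = cplx Mᵀ := by
  ext i j; simp [cplx]

theorem cplx_apply (M : Matrix m n ℝ) (i : m) (j : n) : cplx M i j = (M i j : ℂ) := rfl

end Cplx

section BandTerm

variable {ι κ μ : Type} [Fintype ι]

/-- The Hermitian matrix `e^{-jω₀} Pᴴ Y S + e^{jω₀} Sᴴ Y P - 2 cos r Pᴴ Y P`. -/
noncomputable def bandTerm (ω₀ r : ℝ) (P S : Matrix ι κ ℂ) (Y : Matrix ι ι ℂ) : Matrix κ κ ℂ :=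
  Complex.exp (-(ω₀ * Complex.I)) • (Pᴴ * Y * S) + Complex.exp (ω₀ * Complex.I) • (Sᴴ * Y * P)
    - (2 * Real.cos r : ℂ) • (Pᴴ * Y * P)

theorem bandTerm_mul_right [Fintype κ] (ω₀ r : ℝ) (P S : Matrix ι κ ℂ)
    (Y : Matrix ι ι ℂ) (W : Matrix κ μ ℂ) :
    bandTerm ω₀ r (P * W) (S * W) Y = Wᴴ * bandTerm ω₀ r P S Y * W := by
  simp only [bandTerm, Matrix.conjTranspose_mul, Matrix.mul_add, Matrix.mul_sub, Matrix.add_mul,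
    Matrix.sub_mul, Matrix.mul_smul, Matrix.smul_mul, Matrix.mul_assoc]

theorem bandTerm_mul_left [Fintype μ] (ω₀ r : ℝ) (P S : Matrix ι κ ℂ)
    (Y : Matrix μ μ ℂ) (H : Matrix μ ι ℂ) :
    bandTerm ω₀ r (H * P) (H * S) Y = bandTerm ω₀ r P S (Hᴴ * Y * H) := by
  simp only [bandTerm, Matrix.conjTranspose_mul, Matrix.mul_assoc]

theorem bandTerm_add (ω₀ r : ℝ) (P S : Matrix ι κ ℂ) (Y Z : Matrix ι ι ℂ) :
    bandTerm ω₀ r P S (Y + Z) = bandTerm ω₀ r P S Y + bandTerm ω₀ r P S Z := by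
  simp only [bandTerm, Matrix.mul_add, Matrix.add_mul, smul_add]
  abel

theorem bandTerm_smul (ω₀ r : ℝ) (P S : Matrix ι κ ℂ) (c : ℂ) (Y : Matrix ι ι ℂ) :
    bandTerm ω₀ r P S (c • Y) = c • bandTerm ω₀ r P S Y := by
  simp only [bandTerm, Matrix.mul_smul, Matrix.smul_mul]
  module

end BandTerm

/-! ### Matrix certificates of nonnegativity on the band. -/

section Certificates

open Polynomial

/-- Selection of the first `n` of `n + 1` coordinates. -/
def headSel (n : ℕ) : Matrix (Fin n) (Fin (n + 1)) ℝ :=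
  Matrix.of fun i k => if k = i.castSucc then 1 else 0

/-- Selection of the last `n` of `n + 1` coordinates. -/
def tailSel (n : ℕ) : Matrix (Fin n) (Fin (n + 1)) ℝ :=
  Matrix.of fun i k => if k = i.succ then 1 else 0

/-- The column `(1, z, …, zⁿ)`. -/
def powVec (n : ℕ) (z : ℂ) : Fin (n + 1) → ℂ := fun k => z ^ (k : ℕ)

/-- The real symmetric matrix `R` represents the cosine polynomial `p (cos ω)`. -/
def Represents {n : ℕ} (R : Matrix (Fin (n + 1)) (Fin (n + 1)) ℝ) (p : ℝ[X]) : Prop :=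
  ∀ ω : ℝ, star (powVec n (Complex.exp (ω * Complex.I))) ⬝ᵥ
    (cplx R *ᵥ powVec n (Complex.exp (ω * Complex.I))) = ((p.eval (Real.cos ω) : ℝ) : ℂ)

/-- A real matrix certificate of nonnegativity of the cosine polynomial `p (cos ω)` on the band
with centre `ω₀` and radius `r`. -/
def BandCert (ω₀ r : ℝ) (n : ℕ) (p : ℝ[X]) : Prop :=
  ∃ (R : Matrix (Fin (n + 1)) (Fin (n + 1)) ℝ) (Y : Matrix (Fin n) (Fin n) ℝ),
    R.IsSymm ∧ Y.PosSemidef ∧ Represents R p ∧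
      (cplx R - bandTerm ω₀ r (cplx (headSel n)) (cplx (tailSel n)) (cplx Y)).PosSemidef

theorem BandCert.add {ω₀ r : ℝ} {n : ℕ} {p q : ℝ[X]} (hp : BandCert ω₀ r n p)
    (hq : BandCert ω₀ r n q) : BandCert ω₀ r n (p + q) := by
  obtain ⟨R, Y, hR, hY, hRp, h⟩ := hp
  obtain ⟨R', Y', hR', hY', hRp', h'⟩ := hq
  refine ⟨R + R', Y + Y', hR.add hR', hY.add hY', fun ω => ?_, ?_⟩
  · rw [cplx_add, Matrix.add_mulVec, dotProduct_add, hRp, hRp', eval_add, Complex.ofReal_add]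
  · rw [cplx_add, cplx_add, bandTerm_add]
    convert h.add h' using 1
    abel

/-- The banded Toeplitz matrix of multiplication by the polynomial `h`. -/
def mulMat (h : ℝ[X]) (m n : ℕ) : Matrix (Fin m) (Fin n) ℝ :=
  Matrix.of fun i k => if (i : ℕ) ≤ k then h.coeff (k - i) else 0

theorem headSel_mul_apply {n : ℕ} {κ : Type} (M : Matrix (Fin (n + 1)) κ ℝ) (i : Fin n) (k : κ) :
    (headSel n * M) i k = M i.castSucc k := by
  simp only [Matrix.mul_apply, headSel, Matrix.of_apply, ite_mul, one_mul, zero_mul,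
    Finset.sum_ite_eq', Finset.mem_univ, if_true]

theorem tailSel_mul_apply {n : ℕ} {κ : Type} (M : Matrix (Fin (n + 1)) κ ℝ) (i : Fin n) (k : κ) :
    (tailSel n * M) i k = M i.succ k := by
  simp only [Matrix.mul_apply, tailSel, Matrix.of_apply, ite_mul, one_mul, zero_mul,
    Finset.sum_ite_eq', Finset.mem_univ, if_true]

/-- Multiplication by `h` commutes with the selections. Here the degree bound is needed: the
coefficients `h_{n-i}`, `i < m`, that would reach the last column must vanish. For `tailSel` the
first column is zero by triangularity. -/
theorem headSel_mul_mulMat {h : ℝ[X]} {m n : ℕ} (hmn : h.natDegree + m ≤ n) :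
    headSel m * mulMat h (m + 1) (n + 1) = mulMat h m n * headSel n := by
  ext i k
  rw [headSel_mul_apply]
  induction k using Fin.lastCases with
  | last =>
    have h0 : h.coeff (n - i) = 0 := coeff_eq_zero_of_natDegree_lt (by have := i.2; omega)
    have h1 : ∀ j : Fin n, Fin.last n ≠ j.castSucc := fun j => (Fin.castSucc_lt_last j).ne'
    simp [headSel, mulMat, Matrix.mul_apply, h0, h1]
  | cast k => simp [headSel, mulMat, Matrix.mul_apply]

theorem tailSel_mul_mulMat {h : ℝ[X]} {m n : ℕ} :
    tailSel m * mulMat h (m + 1) (n + 1) = mulMat h m n * tailSel n := by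
  ext i k
  rw [tailSel_mul_apply]
  induction k using Fin.cases with
  | zero =>
    have h1 : ∀ j : Fin n, (0 : Fin (n + 1)) ≠ j.succ := fun j => (Fin.succ_ne_zero j).symm
    simp [tailSel, mulMat, Matrix.mul_apply, h1]
  | succ k => simp [tailSel, mulMat, Matrix.mul_apply]

theorem mulMat_mulVec_powVec {h : ℝ[X]} {m n : ℕ} (hmn : h.natDegree + m ≤ n) (z : ℂ) :
    cplx (mulMat h (m + 1) (n + 1)) *ᵥ powVec n z = aeval z h • powVec m z := by
  ext i
  have hi : (i : ℕ) ≤ m := Nat.lt_succ_iff.1 i.2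
  simp only [Matrix.mulVec, dotProduct, cplx_apply, mulMat, Matrix.of_apply, powVec, Pi.smul_apply,
    smul_eq_mul]
  rw [Fin.sum_univ_eq_sum_range
    (fun k => (((if (i : ℕ) ≤ k then h.coeff (k - i) else 0 : ℝ)) : ℂ) * z ^ k) (n + 1),
    show n + 1 = i + (n - i + 1) by omega, Finset.sum_range_add,
    Finset.sum_eq_zero (fun k hk => by
      rw [if_neg (by have := Finset.mem_range.1 hk; omega)]; simp), zero_add,
    aeval_eq_sum_range' (n := n - i + 1) (by omega), Finset.sum_mul]
  refine Finset.sum_congr rfl fun k _ => ?_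
  simp [pow_add]
  ring

/-- Congruence by the Toeplitz matrix of `h` multiplies the represented function by `|h(z)|²`. Since
that matrix commutes with the selections, the band term keeps its shape, with `Y` replaced by a
congruent matrix. -/
theorem BandCert.mul {ω₀ r : ℝ} {m n : ℕ} {p t h : ℝ[X]} (hp : BandCert ω₀ r m p)
    (hmn : h.natDegree + m ≤ n)
    (ht : ∀ ω : ℝ, star (aeval (Complex.exp (ω * Complex.I)) h)
      * aeval (Complex.exp (ω * Complex.I)) h = ((t.eval (Real.cos ω) : ℝ) : ℂ)) :
    BandCert ω₀ r n (t * p) := by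
  obtain ⟨R, Y, hR, hY, hRp, hpos⟩ := hp
  refine ⟨(mulMat h (m + 1) (n + 1))ᵀ * R * mulMat h (m + 1) (n + 1),
    (mulMat h m n)ᵀ * Y * mulMat h m n, ?_, ?_, fun ω => ?_, ?_⟩
  · rw [Matrix.IsSymm, Matrix.transpose_mul, Matrix.transpose_mul, Matrix.transpose_transpose,
      hR.eq, Matrix.mul_assoc]
  · have := hY.conjTranspose_mul_mul_same (mulMat h m n)
    rwa [Matrix.conjTranspose_eq_transpose_of_trivial] at this
  · have key := hRp ω
    set z := Complex.exp (ω * Complex.I)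
    rw [cplx_mul, cplx_mul, ← conjTranspose_cplx, Matrix.mul_assoc, ← Matrix.mulVec_mulVec,
      ← Matrix.mulVec_mulVec, Matrix.dotProduct_mulVec, ← Matrix.star_mulVec,
      mulMat_mulVec_powVec hmn, Matrix.mulVec_smul, star_smul, smul_dotProduct, dotProduct_smul,
      key, eval_mul, Complex.ofReal_mul, ← ht ω, smul_eq_mul, smul_eq_mul, mul_assoc]
  · have := hpos.conjTranspose_mul_mul_same (cplx (mulMat h (m + 1) (n + 1)))
    rw [Matrix.mul_sub, Matrix.sub_mul, ← bandTerm_mul_right, ← cplx_mul, ← cplx_mul,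
      headSel_mul_mulMat hmn, tailSel_mul_mulMat, cplx_mul, cplx_mul _ (tailSel n),
      bandTerm_mul_left] at this
    simpa only [cplx_mul, ← conjTranspose_cplx] using this

theorem exists_circle_factor (s : ℝ[X]) : ∃ h : ℝ[X], h.natDegree ≤ 2 * s.natDegree ∧
    ∀ ω : ℝ, star (aeval (Complex.exp (ω * Complex.I)) h)
      * aeval (Complex.exp (ω * Complex.I)) h = (((s ^ 2).eval (Real.cos ω) : ℝ) : ℂ) := by
  -- This is `h(z) = z^d s((z + z⁻¹)/2)` with `d = deg s`, cleared of negative powers. On the unit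
  -- circle `|h(z)| = |s(cos ω)|`.
  refine ⟨∑ i ∈ Finset.range (s.natDegree + 1),
    C (s.coeff i) * X ^ (s.natDegree - i) * (C (1 / 2) * (X ^ 2 + 1)) ^ i, ?_, fun ω => ?_⟩
  · refine natDegree_sum_le_of_forall_le _ _ fun i hi => ?_
    have hi' := Finset.mem_range.1 hi
    have h1 : (C (1 / 2 : ℝ) * (X ^ 2 + 1)).natDegree ≤ 2 := by compute_degree
    have h2 := natDegree_pow_le_of_le i h1
    have h3 : (C (s.coeff i) * X ^ (s.natDegree - i) : ℝ[X]).natDegree ≤ s.natDegree - i :=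
      natDegree_C_mul_X_pow_le _ _
    exact (natDegree_mul_le_of_le h3 h2).trans (by omega)
  · set z := Complex.exp (ω * Complex.I) with hz
    have hz1 : star z * z = 1 := by
      rw [hz, Complex.star_def, ← Complex.exp_conj, ← Complex.exp_add]
      simp
    have hcos : ((1 / 2 : ℝ) : ℂ) * (z ^ 2 + 1) = z * Complex.cos ω := by
      push_cast
      rw [Complex.cos, ← hz, neg_mul, Complex.exp_neg, ← hz]
      have : z ≠ 0 := Complex.exp_ne_zero _
      field_simp
    have hval : aeval z (∑ i ∈ Finset.range (s.natDegree + 1),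
        C (s.coeff i) * X ^ (s.natDegree - i) * (C (1 / 2) * (X ^ 2 + 1)) ^ i)
          = z ^ s.natDegree * ((s.eval (Real.cos ω) : ℝ) : ℂ) := by
      rw [eval_eq_sum_range, map_sum, Complex.ofReal_sum, Finset.mul_sum]
      refine Finset.sum_congr rfl fun i hi => ?_
      have hi' := Finset.mem_range.1 hi
      simp only [map_mul, map_pow, aeval_C, aeval_X, map_add, map_one, Complex.coe_algebraMap,
        Complex.ofReal_mul, Complex.ofReal_pow, hcos, Complex.ofReal_cos]
      rw [mul_pow]
      conv_rhs => rw [← Nat.sub_add_cancel (Nat.lt_succ_iff.1 hi'), pow_add]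
      ring
    rw [hval, star_mul', star_pow, eval_pow, Complex.ofReal_pow]
    have : (star ((s.eval (Real.cos ω) : ℝ) : ℂ)) = ((s.eval (Real.cos ω) : ℝ) : ℂ) :=
      Complex.conj_ofReal _
    rw [this]
    have h2 : star z ^ s.natDegree * z ^ s.natDegree = 1 := by rw [← mul_pow, hz1, one_pow]
    linear_combination (((s.eval (Real.cos ω) : ℝ) : ℂ)) ^ 2 * h2

end Certificates

/-! ### Explicit certificates for the weights. -/

section BaseCertificates

open Polynomial

theorem exp_ofReal_mul_I (ω : ℝ) :
    Complex.exp (ω * Complex.I) = (Real.cos ω : ℂ) + (Real.sin ω : ℂ) * Complex.I := by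
  rw [Complex.exp_mul_I, Complex.ofReal_cos, Complex.ofReal_sin]

theorem exp_neg_ofReal_mul_I (ω : ℝ) :
    Complex.exp (-(ω * Complex.I)) = (Real.cos ω : ℂ) - (Real.sin ω : ℂ) * Complex.I := by
  have := exp_ofReal_mul_I (-ω)
  simpa [sub_eq_add_neg] using this

theorem smul_vecMulVec_posSemidef {n : Type} [Finite n] {c : ℝ} (hc : 0 ≤ c) (u : n → ℂ) :
    ((c : ℂ) • Matrix.vecMulVec (star u) u).PosSemidef :=
  (Matrix.posSemidef_vecMulVec_star_self u).smul (by exact_mod_cast hc)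

theorem bandCert_one (ω₀ r : ℝ) : BandCert ω₀ r 0 1 := by
  refine ⟨1, 0, Matrix.isSymm_one, Matrix.PosSemidef.zero, fun ω => ?_, ?_⟩
  · simp [cplx_one, powVec, dotProduct]
  · have : bandTerm ω₀ r (cplx (headSel 0)) (cplx (tailSel 0)) (cplx 0) = 0 := by
      simp [bandTerm, cplx_zero]
    rw [this, sub_zero, cplx_one]
    exact Matrix.PosSemidef.one

/-- Used for `(ε, θ) = (1, ω₂)` and `(-1, ω₁)`. The identity behind it is `ε (cos ω - cos θ) = 2k
(cos (ω - ω₀) - cos r) + l |1 - e^{-jθ} z|²` with `k = sin θ / (2 sin r)` and `l = sin ω₀ / (2 sin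
r)`; both constants are nonnegative. -/
theorem bandCert_linear {ω₀ r θ ε : ℝ} (hr : 0 < Real.sin r) (hθ : 0 ≤ Real.sin θ)
    (hω₀ : 0 ≤ Real.sin ω₀)
    (h1 : Real.sin θ * Real.cos ω₀ - Real.cos θ * Real.sin ω₀ = ε * Real.sin r)
    (h2 : Real.sin ω₀ = Real.sin θ * Real.cos r - ε * Real.cos θ * Real.sin r) :
    BandCert ω₀ r 1 (C ε * (X - C (Real.cos θ))) := by
  obtain ⟨k, hk⟩ : ∃ k, Real.sin θ = 2 * k * Real.sin r :=
    ⟨Real.sin θ / (2 * Real.sin r), by field_simp⟩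
  obtain ⟨l, hl⟩ : ∃ l, Real.sin ω₀ = 2 * l * Real.sin r :=
    ⟨Real.sin ω₀ / (2 * Real.sin r), by field_simp⟩
  have hk0 : 0 ≤ k := by
    by_contra hneg
    nlinarith
  have hl0 : 0 ≤ l := by
    by_contra hneg
    nlinarith
  have e1 : l * Real.sin θ = k * Real.sin ω₀ := by rw [hk, hl]; ring
  have e2 : k * Real.cos ω₀ - l * Real.cos θ = ε / 2 :=
    mul_left_cancel₀ (mul_pos two_pos hr).ne' (by
      linear_combination h1 - Real.cos ω₀ * hk + Real.cos θ * hl)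
  have e3 : 2 * l - 2 * k * Real.cos r = - (ε * Real.cos θ) :=
    mul_left_cancel₀ hr.ne' (by linear_combination h2 - hl + Real.cos r * hk)
  refine ⟨!![l - 2 * k * Real.cos r, ε / 2; ε / 2, l], !![k], ?_, ?_, fun ω => ?_, ?_⟩
  · ext i j; fin_cases i <;> fin_cases j <;> rfl
  · have : !![k] = k • (1 : Matrix (Fin 1) (Fin 1) ℝ) := by
      ext i j; fin_cases i; fin_cases j; simp
    rw [this]
    exact Matrix.PosSemidef.one.smul hk0
  · have hcs := Real.sin_sq_add_cos_sq ω
    have hv : ∀ z : ℂ, powVec 1 z = ![1, z] := fun z => by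
      ext i; fin_cases i <;> simp [powVec]
    simp only [hv, exp_ofReal_mul_I, eval_mul, eval_sub, eval_X, eval_C]
    generalize Real.sin ω = s at *
    generalize Real.cos ω = c at *
    generalize Real.cos θ = ct at *
    generalize Real.cos r = cr at *
    apply Complex.ext
    · simp [dotProduct, Matrix.mulVec, Fin.sum_univ_two, cplx_apply]
      linear_combination l * hcs + e3
    · simp [dotProduct, Matrix.mulVec, Fin.sum_univ_two, cplx_apply]
      ring
  · convert smul_vecMulVec_posSemidef hl0
      ![1, -((Real.cos θ : ℂ) - (Real.sin θ : ℂ) * Complex.I)] using 1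
    have hcs := Real.sin_sq_add_cos_sq θ
    simp only [bandTerm, exp_ofReal_mul_I, exp_neg_ofReal_mul_I]
    generalize Real.sin θ = st at *
    generalize Real.cos θ = ct at *
    generalize Real.cos r = cr at *
    generalize Real.sin ω₀ = s₀ at *
    generalize Real.cos ω₀ = c₀ at *
    have hh : cplx (headSel 1) = !![1, 0] := by
      ext i j; fin_cases i; fin_cases j <;> simp [cplx, headSel]
    have ht : cplx (tailSel 1) = !![0, 1] := by
      ext i j; fin_cases i; fin_cases j <;> simp [cplx, tailSel]
    rw [hh, ht]
    ext i j
    fin_cases i <;> fin_cases j <;> apply Complex.ext <;>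
      simp [Matrix.mul_apply, Matrix.vecMulVec, cplx_apply]
    all_goals
      first
      | ring1
      | linear_combination e1
      | linear_combination e2
      | linear_combination -e1
      | linear_combination -e2
      | linear_combination -l * hcs
      | linear_combination l * hcs
      | (right; ring1)

/-- With `δ = cos (ω - ω₀) - cos r`, the product of the two weights is `δ² + 2δ (cos r - cos ω₀ cos
ω)`. The bracket is the form of `Y` at `(1, z)`, and the eigenvalues `(cos r ± cos ω₀) / 2` of `Y`
are nonnegative by hypothesis. The residual `δ²` is a quarter of the squared modulus of `e^{jω₀} - 2
cos r z + e^{-jω₀} z²`. -/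
theorem bandCert_quadratic {ω₀ r : ℝ} (h1 : |Real.cos ω₀| ≤ Real.cos r) :
    BandCert ω₀ r 2 ((X - C (Real.cos (ω₀ + r))) * (C (Real.cos (ω₀ - r)) - X)) := by
  have hY : (!![Real.cos r / 2, -Real.cos ω₀ / 2; -Real.cos ω₀ / 2, Real.cos r / 2]).PosSemidef :=
      by
    refine Matrix.PosSemidef.of_dotProduct_mulVec_nonneg ?_ fun x => ?_
    · ext i j; fin_cases i <;> fin_cases j <;> simp
    · have h2 := abs_le.1 h1
      simp [dotProduct, Matrix.mulVec, Fin.sum_univ_two]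
      nlinarith [mul_nonneg (sub_nonneg.2 h2.2) (sq_nonneg (x 0 + x 1)),
        mul_nonneg (neg_le_iff_add_nonneg.1 h2.1) (sq_nonneg (x 0 - x 1))]
  refine ⟨!![1 / 4 - Real.cos r * Real.cos r, Real.cos r * Real.cos ω₀, -1 / 4;
    Real.cos r * Real.cos ω₀, -(Real.cos ω₀ * Real.cos ω₀), 0;
    -1 / 4, 0, 1 / 4], _, ?_, hY, fun ω => ?_, ?_⟩
  · ext i j; fin_cases i <;> fin_cases j <;> rfl
  · have hcs := Real.sin_sq_add_cos_sq ω
    have hcs₀ := Real.sin_sq_add_cos_sq ω₀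
    have hcr := Real.sin_sq_add_cos_sq r
    have hv : ∀ z : ℂ, powVec 2 z = ![1, z, z * z] := fun z => by
      ext i; fin_cases i <;> simp [powVec, sq]
    simp only [hv, exp_ofReal_mul_I, eval_mul, eval_sub, eval_X, eval_C, Real.cos_add,
      Real.cos_sub]
    generalize Real.sin ω = s at *
    generalize Real.cos ω = c at *
    generalize Real.sin r = sr at *
    generalize Real.cos r = cr at *
    generalize Real.sin ω₀ = s₀ at *
    generalize Real.cos ω₀ = c₀ at *
    apply Complex.ext
    · simp [dotProduct, Matrix.mulVec, Fin.sum_univ_three, cplx_apply]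
      linear_combination ((c ^ 2 + s ^ 2 + 3) / 4 - c₀ ^ 2) * hcs - sr ^ 2 * hcs₀
        - (1 - c₀ ^ 2) * hcr
    · simp [dotProduct, Matrix.mulVec, Fin.sum_univ_three, cplx_apply]
      ring
  · convert smul_vecMulVec_posSemidef (c := 1 / 4) (by norm_num)
      ![(Real.cos ω₀ : ℂ) + (Real.sin ω₀ : ℂ) * Complex.I, -2 * (Real.cos r : ℂ),
        (Real.cos ω₀ : ℂ) - (Real.sin ω₀ : ℂ) * Complex.I] using 1
    have hcs := Real.sin_sq_add_cos_sq ω₀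
    simp only [bandTerm, exp_ofReal_mul_I, exp_neg_ofReal_mul_I]
    generalize Real.cos r = cr at *
    generalize Real.sin ω₀ = s₀ at *
    generalize Real.cos ω₀ = c₀ at *
    have hh : cplx (headSel 2) = !![1, 0, 0; 0, 1, 0] := by
      ext i j; fin_cases i <;> fin_cases j <;> simp [cplx, headSel]
    have ht : cplx (tailSel 2) = !![0, 1, 0; 0, 0, 1] := by
      ext i j; fin_cases i <;> fin_cases j <;> simp [cplx, tailSel]
    rw [hh, ht]
    ext i j
    fin_cases i <;> fin_cases j <;> apply Complex.ext <;>
      simp [Matrix.mul_apply, Matrix.vecMulVec, cplx_apply, Fin.sum_univ_two]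
    all_goals
      first
      | ring1
      | linear_combination (-1 / 4 : ℝ) * hcs
      | linear_combination (1 / 4 : ℝ) * hcs
      | linear_combination hcs

/-- A real polynomial of degree at most `n` that is nonnegative on the cosines of the band has a
real matrix certificate. -/
theorem bandCert_of_nonneg {ω₁ ω₂ : ℝ} (hω₁ : 0 ≤ ω₁) (hω : ω₁ < ω₂) (hω₂ : ω₂ ≤ Real.pi)
    {n : ℕ} {p : ℝ[X]} (hdeg : p.natDegree ≤ n)
    (hp : ∀ ω ∈ Set.Icc ω₁ ω₂, 0 ≤ p.eval (Real.cos ω)) :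
    BandCert ((ω₁ + ω₂) / 2) ((ω₂ - ω₁) / 2) n p := by
  set ω₀ := (ω₁ + ω₂) / 2 with hω₀
  set r := (ω₂ - ω₁) / 2 with hr
  have hsum : ω₀ + r = ω₂ := by rw [hω₀, hr]; ring
  have hdiff : ω₀ - r = ω₁ := by rw [hω₀, hr]; ring
  have hsr : 0 < Real.sin r := Real.sin_pos_of_pos_of_lt_pi (by linarith) (by linarith)
  have hs0 : 0 ≤ Real.sin ω₀ := Real.sin_nonneg_of_nonneg_of_le_pi (by linarith) (by linarith)
  have hs1 : 0 ≤ Real.sin ω₁ := Real.sin_nonneg_of_nonneg_of_le_pi (by linarith) (by linarith)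
  have hs2 : 0 ≤ Real.sin ω₂ := Real.sin_nonneg_of_nonneg_of_le_pi (by linarith) (by linarith)
  have hcos : Real.cos ω₂ < Real.cos ω₁ :=
    Real.strictAntiOn_cos ⟨hω₁, by linarith⟩ ⟨by linarith, hω₂⟩ hω
  have hleft : BandCert ω₀ r 1 (X - C (Real.cos ω₂)) := by
    have := bandCert_linear (ε := 1) hsr hs2 hs0
      (by rw [← Real.sin_sub, one_mul]; congr 1; linarith)
      (by
        have : Real.sin ω₀ = Real.sin (ω₂ - r) := by congr 1; linarith
        rw [this, Real.sin_sub]; ring)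
    simpa using this
  have hright : BandCert ω₀ r 1 (C (Real.cos ω₁) - X) := by
    have := bandCert_linear (ε := -1) hsr hs1 hs0
      (by
        have : -1 * Real.sin r = Real.sin (ω₁ - ω₀) := by
          rw [neg_one_mul, ← Real.sin_neg]; congr 1; linarith
        rw [this, Real.sin_sub])
      (by
        have : Real.sin ω₀ = Real.sin (ω₁ + r) := by congr 1; linarith
        rw [this, Real.sin_add]; ring)
    simpa using this
  have hboth : BandCert ω₀ r 2 ((X - C (Real.cos ω₂)) * (C (Real.cos ω₁) - X)) := by
    have := bandCert_quadratic (ω₀ := ω₀) (r := r) (abs_le.2 ⟨?_, ?_⟩)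
    · rwa [hsum, hdiff] at this
    · rw [neg_le, ← Real.cos_pi_sub]
      exact Real.cos_le_cos_of_nonneg_of_le_pi (by linarith) (by linarith) (by linarith)
    · exact Real.cos_le_cos_of_nonneg_of_le_pi (by linarith) (by linarith) (by linarith)
  -- The substitution `x = cos ω` reverses the order, so the band becomes `[cos ω₂, cos ω₁]`. The
  -- circle factor of `s` has degree at most `2 deg s`, which together with the size of the weight's
  -- certificate is exactly what the cone allows.
  have hcone : IntervalSOS (Real.cos ω₂) (Real.cos ω₁) n p := by
    refine IntervalSOS.of_nonneg hcos n p hdeg fun x hx => ?_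
    have hx1 : -1 ≤ x := (Real.neg_one_le_cos _).trans hx.1
    have hx2 : x ≤ 1 := hx.2.trans (Real.cos_le_one _)
    have := hp (Real.arccos x) ⟨?_, ?_⟩
    · rwa [Real.cos_arccos hx1 hx2] at this
    · have h := Real.arccos_le_arccos hx.2
      rwa [Real.arccos_cos hω₁ (by linarith)] at h
    · have h := Real.arccos_le_arccos hx.1
      rwa [Real.arccos_cos (by linarith) hω₂] at h
  clear hp hdeg
  induction hcone with
  | sq s hs =>
    obtain ⟨h, hh, hval⟩ := exists_circle_factor s
    simpa using (bandCert_one ω₀ r).mul (n := n) (by omega) hval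
  | left s hs =>
    obtain ⟨h, hh, hval⟩ := exists_circle_factor s
    rw [mul_comm]
    exact hleft.mul (by omega) hval
  | right s hs =>
    obtain ⟨h, hh, hval⟩ := exists_circle_factor s
    rw [mul_comm]
    exact hright.mul (by omega) hval
  | both s hs =>
    obtain ⟨h, hh, hval⟩ := exists_circle_factor s
    rw [mul_comm]
    exact hboth.mul (by omega) hval
  | add p q _ _ hp hq => exact hp.add hq

end BaseCertificates

/-! ### Real symmetric forms on the curve `(1, z, …, zⁿ)`, and the KYP lemma for a shift. -/

section TrigonometricForms

open Polynomial

variable {n : ℕ}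

theorem star_exp_pow_mul_exp_pow (ω : ℝ) (i k : ℕ) :
    star (Complex.exp (ω * Complex.I)) ^ i * Complex.exp (ω * Complex.I) ^ k
      = Complex.exp (((((k : ℤ) - i : ℤ) : ℝ) * ω : ℝ) * Complex.I) := by
  rw [Complex.star_def, ← Complex.exp_conj, ← Complex.exp_nat_mul, ← Complex.exp_nat_mul,
    ← Complex.exp_add]
  congr 1
  simp
  ring

theorem powVec_form (R : Matrix (Fin (n + 1)) (Fin (n + 1)) ℝ) (z : ℂ) :
    star (powVec n z) ⬝ᵥ (cplx R *ᵥ powVec n z)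
      = ∑ i, ∑ k, (R i k : ℂ) * (star z ^ (i : ℕ) * z ^ (k : ℕ)) := by
  simp only [dotProduct, Matrix.mulVec, Finset.mul_sum, cplx_apply, powVec, Pi.star_apply, star_pow]
  refine Finset.sum_congr rfl fun i _ => Finset.sum_congr rfl fun k _ => by ring

/-- The entry `(i, k)` contributes `z^{k-i}`. Symmetry cancels the sines in pairs, and `cos ((k - i)
ω)` is a Chebyshev polynomial in `cos ω`. -/
theorem exists_represents {R : Matrix (Fin (n + 1)) (Fin (n + 1)) ℝ} (hR : R.IsSymm) :
    ∃ p : ℝ[X], p.natDegree ≤ n ∧ Represents R p := by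
  refine ⟨∑ i : Fin (n + 1), ∑ k : Fin (n + 1),
    C (R i k) * Chebyshev.T ℝ ((k : ℤ) - (i : ℤ)), ?_, fun ω => ?_⟩
  · refine natDegree_sum_le_of_forall_le _ _ fun i _ => natDegree_sum_le_of_forall_le _ _ fun k _ =>
      (natDegree_C_mul_le _ _).trans ?_
    rw [Chebyshev.natDegree_T]
    have := i.2; have := k.2; omega
  · rw [powVec_form]
    simp only [star_exp_pow_mul_exp_pow]
    apply Complex.ext
    · simp only [Complex.re_sum, Complex.re_ofReal_mul, Complex.exp_ofReal_mul_I_re,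
        Complex.ofReal_re, eval_finsetSum, eval_mul, eval_C, Chebyshev.T_real_cos]
    · simp only [Complex.im_sum, Complex.im_ofReal_mul, Complex.exp_ofReal_mul_I_im,
        Complex.ofReal_im]
      have hneg : (∑ i : Fin (n + 1), ∑ k : Fin (n + 1),
          R i k * Real.sin ((((k : ℕ) : ℤ) - ((i : ℕ) : ℤ) : ℤ) * ω))
          = -∑ i : Fin (n + 1), ∑ k : Fin (n + 1),
          R i k * Real.sin ((((k : ℕ) : ℤ) - ((i : ℕ) : ℤ) : ℤ) * ω) := by
        conv_lhs => rw [Finset.sum_comm]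
        rw [← Finset.sum_neg_distrib]
        refine Finset.sum_congr rfl fun i _ => ?_
        rw [← Finset.sum_neg_distrib]
        refine Finset.sum_congr rfl fun k _ => ?_
        rw [hR.apply, ← mul_neg, ← Real.sin_neg]
        congr 2
        push_cast
        ring
      linarith

/-- Partial sums of `d` along its diagonals. -/
def diagSum (d : ℕ → ℕ → ℝ) : ℕ → ℕ → ℝ
  | 0, j => d 0 j
  | i + 1, 0 => d (i + 1) 0
  | i + 1, j + 1 => diagSum d i j + d (i + 1) (j + 1)

theorem diagSum_symm {d : ℕ → ℕ → ℝ} (hd : ∀ i j, d i j = d j i) :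
    ∀ i j, diagSum d i j = diagSum d j i
  | 0, 0 => rfl
  | 0, j + 1 => hd 0 (j + 1)
  | i + 1, 0 => hd (i + 1) 0
  | i + 1, j + 1 => by
    rw [diagSum, diagSum, diagSum_symm hd i j, hd]

theorem diagSum_eq_sum (d : ℕ → ℕ → ℝ) : ∀ j i, j ≤ i →
    diagSum d i j = ∑ k ∈ Finset.range (j + 1), d (i - j + k) k
  | 0, 0, _ => by simp [diagSum]
  | 0, i + 1, _ => by simp [diagSum]
  | j + 1, 0, h => by omega
  | j + 1, i + 1, h => by
    rw [diagSum, Finset.sum_range_succ, diagSum_eq_sum d j i (by omega), Nat.add_sub_add_right,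
      show i - j + (j + 1) = i + 1 by omega]

theorem tailSel_conj_apply (x : ℕ → ℕ → ℝ) (i k : Fin (n + 1)) :
    ((tailSel n)ᵀ * (Matrix.of fun i j : Fin n => x i j) * tailSel n) i k
      = if 1 ≤ (i : ℕ) ∧ 1 ≤ (k : ℕ) then x (i - 1) (k - 1) else 0 := by
  have h1 : ∀ j : Fin n, (0 : Fin (n + 1)) ≠ j.succ := fun j => (Fin.succ_ne_zero j).symm
  induction i using Fin.cases <;> induction k using Fin.cases <;>
    simp [tailSel, Matrix.mul_apply, h1]

theorem headSel_conj_apply (x : ℕ → ℕ → ℝ) (i k : Fin (n + 1)) :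
    ((headSel n)ᵀ * (Matrix.of fun i j : Fin n => x i j) * headSel n) i k
      = if (i : ℕ) < n ∧ (k : ℕ) < n then x i k else 0 := by
  have h1 : ∀ j : Fin n, Fin.last n ≠ j.castSucc := fun j => (Fin.castSucc_lt_last j).ne'
  induction i using Fin.lastCases <;> induction k using Fin.lastCases <;>
    simp [headSel, Matrix.mul_apply, h1]

/-- If a form vanishes on all vectors `(1, z, …, zⁿ)` with `|z| = 1`, then its diagonal sums
vanish. -/
theorem diagSum_last_eq_zero {d : ℕ → ℕ → ℝ}
    (h : ∀ ω : ℝ, ∑ i : Fin (n + 1), ∑ k : Fin (n + 1), (d i k : ℂ) *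
      (star (Complex.exp (ω * Complex.I)) ^ (i : ℕ) * Complex.exp (ω * Complex.I) ^ (k : ℕ)) = 0)
    {j : ℕ} (hj : j ≤ n) : diagSum d n j = 0 := by
  -- Multiplying by `zⁿ` clears the negative powers. The coefficient of `z^j` collects the entries
  -- with `k - i = j - n`, that is, the diagonal ending at `(n, j)`.
  set P : ℂ[X] := ∑ i : Fin (n + 1), ∑ k : Fin (n + 1),
    C (d i k : ℂ) * X ^ ((k : ℕ) + (n - i)) with hP
  have hroot : ∀ ω : ℝ, P.IsRoot (Complex.exp (ω * Complex.I)) := by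
    intro ω
    have hz : star (Complex.exp (ω * Complex.I)) * Complex.exp (ω * Complex.I) = 1 := by
      have := star_exp_pow_mul_exp_pow ω 1 1
      simpa using this
    have := congrArg (fun w => Complex.exp (ω * Complex.I) ^ n * w) (h ω)
    simp only [mul_zero, Finset.mul_sum] at this
    rw [IsRoot.def, hP, eval_finsetSum, ← this]
    refine Finset.sum_congr rfl fun i _ => ?_
    rw [eval_finsetSum]
    refine Finset.sum_congr rfl fun k _ => ?_
    generalize Complex.exp (ω * Complex.I) = z at hz
    rw [eval_mul, eval_C, eval_pow, eval_X]
    have hzn : z ^ n = z ^ (n - (i : ℕ)) * z ^ (i : ℕ) := by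
      rw [← pow_add, Nat.sub_add_cancel (Nat.lt_succ_iff.1 i.2)]
    have h2 : star z ^ (i : ℕ) * z ^ (i : ℕ) = 1 := by rw [← mul_pow, hz, one_pow]
    rw [pow_add, hzn]
    linear_combination -(z ^ (n - (i : ℕ)) * (d i k) * z ^ (k : ℕ)) * h2
  have hP0 : P = 0 := by
    refine eq_zero_of_infinite_isRoot P ?_
    -- The upper half circle already supplies infinitely many roots, as `cos` is injective on `[0,
    -- π]`.
    refine Set.infinite_of_injOn_mapsTo (s := Set.Icc (0 : ℝ) Real.pi)
      (f := fun ω : ℝ => Complex.exp (ω * Complex.I)) (fun a ha b hb hab => ?_)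
      (fun ω _ => hroot ω) (Set.Icc_infinite Real.pi_pos)
    have := congrArg Complex.re hab
    simp only [Complex.exp_ofReal_mul_I_re] at this
    exact Real.injOn_cos ha hb this
  have hcoeff := congrArg (fun q => coeff q j) hP0
  simp only [hP, finsetSum_coeff, coeff_C_mul, coeff_X_pow, coeff_zero, mul_ite, mul_one,
    mul_zero] at hcoeff
  rw [Finset.sum_comm] at hcoeff
  have hreal : ∑ k : Fin (n + 1), ∑ i : Fin (n + 1),
      (if j = (k : ℕ) + (n - i) then d i k else 0) = 0 := by
    have := congrArg Complex.re hcoeff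
    simpa [Complex.re_sum, apply_ite Complex.re] using this
  rw [diagSum_eq_sum d j n hj, ← hreal, Fin.sum_univ_eq_sum_range
    (fun k => ∑ i : Fin (n + 1), (if j = k + (n - i) then d i k else 0)) (n + 1),
    ← Finset.sum_subset (Finset.range_mono (Nat.succ_le_succ hj)) fun k _ hk =>
      Finset.sum_eq_zero fun i _ => if_neg (by have := mt Finset.mem_range.2 hk; omega)]
  refine Finset.sum_congr rfl fun k hk => ?_
  have hk' := Finset.mem_range.1 hk
  rw [Finset.sum_eq_single (⟨n - j + k, by omega⟩ : Fin (n + 1))]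
  · rw [if_pos (by simp only []; omega)]
  · intro i _ hi
    refine if_neg fun hji => hi ?_
    ext
    have := i.2
    simp only []
    omega
  · simp

/-- A real symmetric form that vanishes on all vectors `(1, z, …, zⁿ)` with `|z| = 1` is a
telescoping difference of shifted forms. -/
theorem exists_telescoping {D : Matrix (Fin (n + 1)) (Fin (n + 1)) ℝ} (hD : D.IsSymm)
    (h : ∀ ω : ℝ, star (powVec n (Complex.exp (ω * Complex.I))) ⬝ᵥ
      (cplx D *ᵥ powVec n (Complex.exp (ω * Complex.I))) = 0) :
    ∃ X : Matrix (Fin n) (Fin n) ℝ, X.IsSymm ∧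
      D = (tailSel n)ᵀ * X * tailSel n - (headSel n)ᵀ * X * headSel n := by
  set d : ℕ → ℕ → ℝ := fun i j => if hij : i < n + 1 ∧ j < n + 1 then D ⟨i, hij.1⟩ ⟨j, hij.2⟩ else 0
    with hd
  have hdD : ∀ i k : Fin (n + 1), d i k = D i k := fun i k => by
    simp only [hd]; rw [dif_pos ⟨i.2, k.2⟩]
  have hsymm : ∀ i j, d i j = d j i := fun i j => by
    simp only [hd]
    by_cases hij : i < n + 1 ∧ j < n + 1
    · rw [dif_pos hij, dif_pos hij.symm, hD.apply]
    · rw [dif_neg hij, dif_neg (fun h => hij h.symm)]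
  have hlast : ∀ j ≤ n, diagSum d n j = 0 := fun j hj =>
    diagSum_last_eq_zero (fun ω => by simpa only [powVec_form, hdD] using h ω) hj
  have hlast' : ∀ i ≤ n, diagSum d i n = 0 := fun i hi => by
    rw [diagSum_symm hsymm, hlast i hi]
  -- Successive partial sums along a diagonal differ by one entry of `D`, so `X_{i-1,k-1} - X_{i,k}
  -- = D_{i,k}`. In the last row and column `X` has no entry; there the complete diagonal sum is
  -- zero, so the formula persists.
  refine ⟨Matrix.of fun i j => -diagSum d i j, ?_, ?_⟩
  · ext i j
    simp [diagSum_symm hsymm (j : ℕ) i]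
  · ext i k
    rw [Matrix.sub_apply, tailSel_conj_apply (fun i j => -diagSum d i j),
      headSel_conj_apply (fun i j => -diagSum d i j), ← hdD]
    obtain ⟨i, hi⟩ := i
    obtain ⟨k, hk⟩ := k
    simp only []
    have hin : ¬ (i < n ∧ k < n) → diagSum d i k = 0 := by
      intro hnot
      rcases Nat.lt_or_ge i n with h1 | h1
      · rw [show k = n by omega, hlast' i (by omega)]
      · rw [show i = n by omega, hlast k (by omega)]
    have hrhs : (if i < n ∧ k < n then -diagSum d i k else 0) = -diagSum d i k := by
      split_ifs with hc
      · rfl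
      · rw [hin hc, neg_zero]
    rw [hrhs]
    rcases i with _ | i
    · simp [diagSum]
    · rcases k with _ | k
      · simp [diagSum]
      · simp [diagSum]

end TrigonometricForms

section PolynomialKYP

variable {n : ℕ}

/-- Generalized KYP lemma with real multipliers, for a real form in the coordinates in which the
state equation is a shift. -/
theorem exists_shift_multipliers {ω₁ ω₂ : ℝ} (hω₁ : 0 ≤ ω₁) (hω : ω₁ < ω₂) (hω₂ : ω₂ ≤ Real.pi)
    {Q : Matrix (Fin (n + 1)) (Fin (n + 1)) ℝ} (hQ : Q.IsSymm)
    (h : ∀ ω ∈ Set.Icc ω₁ ω₂, 0 ≤ star (powVec n (Complex.exp (ω * Complex.I))) ⬝ᵥ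
      (cplx Q *ᵥ powVec n (Complex.exp (ω * Complex.I)))) :
    ∃ X Y : Matrix (Fin n) (Fin n) ℝ, X.IsSymm ∧ Y.PosSemidef ∧
      (cplx Q - (cplx (tailSel n)ᵀ * cplx X * cplx (tailSel n)
          - cplx (headSel n)ᵀ * cplx X * cplx (headSel n))
        - bandTerm ((ω₁ + ω₂) / 2) ((ω₂ - ω₁) / 2) (cplx (headSel n)) (cplx (tailSel n))
          (cplx Y)).PosSemidef := by
  obtain ⟨p, hdeg, hp⟩ := exists_represents hQ
  obtain ⟨R, Y, hR, hY, hRp, hpos⟩ := bandCert_of_nonneg hω₁ hω hω₂ hdeg fun ω hω => by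
    have := h ω hω
    rw [hp] at this
    exact_mod_cast this
  -- `Q` and `R` represent the same polynomial, so their difference vanishes on the whole circle and
  -- not only on the band.
  obtain ⟨X, hX, hXD⟩ := exists_telescoping (hQ.sub hR) fun ω => by
    rw [cplx_sub, Matrix.sub_mulVec, dotProduct_sub, hp, hRp, sub_self]
  refine ⟨X, Y, hX, hY, ?_⟩
  rwa [← cplx_mul, ← cplx_mul, ← cplx_mul, ← cplx_mul, ← cplx_sub, ← hXD, cplx_sub,
    sub_sub_cancel]

end PolynomialKYP

/-! ### The KYP matrix as a sum of congruences, and the necessity of the inequality. -/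

section Factorization

variable {ι : Type} [DecidableEq ι]

/-- `(x, u, w) ↦ x`. -/
def stateSel (ι : Type) [DecidableEq ι] : Matrix ι ((ι ⊕ Unit) ⊕ Unit) ℝ :=
  Matrix.fromCols (Matrix.fromCols 1 0) 0

/-- `(x, u, w) ↦ u`. -/
def inputSel (ι : Type) : Matrix Unit ((ι ⊕ Unit) ⊕ Unit) ℝ :=
  Matrix.fromCols (Matrix.fromCols 0 1) 0

/-- `(x, u, w) ↦ A x + B u`. -/
def nextSel (A : Matrix ι ι ℝ) (B : Matrix ι Unit ℝ) : Matrix ι ((ι ⊕ Unit) ⊕ Unit) ℝ :=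
  Matrix.fromCols (Matrix.fromCols A B) 0

/-- `(x, u, w) ↦ C x + D u`. -/
def outputSel (C : Matrix Unit ι ℝ) (D : ℝ) : Matrix Unit ((ι ⊕ Unit) ⊕ Unit) ℝ :=
  Matrix.fromCols (Matrix.fromCols C (D • 1)) 0

/-- `(x, u, w) ↦ C x + D u - w`. -/
def residualSel (C : Matrix Unit ι ℝ) (D : ℝ) : Matrix Unit ((ι ⊕ Unit) ⊕ Unit) ℝ :=
  Matrix.fromCols (Matrix.fromCols C (D • 1)) (-1)

theorem cplx_fromCols {m n₁ n₂ : Type} (M : Matrix m n₁ ℝ) (N : Matrix m n₂ ℝ) :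
    cplx (Matrix.fromCols M N) = Matrix.fromCols (cplx M) (cplx N) := by
  ext i (j | j) <;> rfl

theorem cplx_neg {m n : Type} (M : Matrix m n ℝ) : cplx (-M) = -cplx M := by
  ext i j; simp [cplx]

theorem fromRows_mul_mul_fromCols {m₁ m₂ n₁ n₂ k l : Type} [Fintype k] [Fintype l]
    (P : Matrix m₁ k ℂ) (Q : Matrix m₂ k ℂ) (X : Matrix k l ℂ) (R : Matrix l n₁ ℂ)
    (S : Matrix l n₂ ℂ) :
    Matrix.fromRows P Q * X * Matrix.fromCols R S
      = Matrix.fromBlocks (P * X * R) (P * X * S) (Q * X * R) (Q * X * S) := by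
  rw [Matrix.fromRows_mul, Matrix.fromRows_mul_fromCols]

variable [Fintype ι]

/-- The output blocks come from `|Cx + Du|² - |Cx + Du - w|²`, whose expansion is `2 Re (w* (Cx +
Du)) - |w|²`: affine in `(C, D)`, and equal to the output energy when `w = Cx + Du`. -/
theorem gkypMatrix_eq (G : StateSpace ι) (ω₁ ω₂ : ℝ) {X Y : Matrix ι ι ℝ} (hX : X.IsSymm)
    (hY : Y.IsSymm) (g : ℝ) :
    gkypMatrix G ω₁ ω₂ X Y g =
      (cplx (nextSel G.A G.B))ᴴ * cplx X * cplx (nextSel G.A G.B)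
        - (cplx (stateSel ι))ᴴ * cplx X * cplx (stateSel ι)
        + bandTerm ((ω₁ + ω₂) / 2) ((ω₂ - ω₁) / 2) (cplx (stateSel ι)) (cplx (nextSel G.A G.B))
          (cplx Y)
        - (g : ℂ) • ((cplx (inputSel ι))ᴴ * cplx (inputSel ι))
        + (cplx (outputSel G.C G.D))ᴴ * cplx (outputSel G.C G.D)
        - (cplx (residualSel G.C G.D))ᴴ * cplx (residualSel G.C G.D) := by
  simp only [bandTerm, nextSel, stateSel, inputSel, outputSel, residualSel, cplx_fromCols,
    Matrix.conjTranspose_fromCols_eq_fromRows_conjTranspose, fromRows_mul_mul_fromCols,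
    Matrix.fromRows_mul_fromCols, conjTranspose_cplx, gkypMatrix, gkypM1, gkypM2, gkypM3]
  have hX' := hX.eq
  have hY' := hY.eq
  ext ((i | i) | i) ((j | j) | j) <;>
    simp [cplx_mul, cplx_smul, cplx_zero, cplx_one, cplx_neg, cplx_transpose,
      Matrix.fromRows_mul, Matrix.mul_assoc]
  · ring
  · rw [← cplx_transpose X, ← cplx_transpose Y, hX', hY']

end Factorization

section Necessity

variable {ι : Type} [Fintype ι] [DecidableEq ι] {n : ℕ}

/-- If coordinates `E`, `a` turn `x⁺ = A x + B u` into a shift register, then the bound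
`|C x + D u|² ≤ g |u|²` along all harmonic trajectories in the band gives real multipliers for
the generalized KYP inequality. -/
theorem exists_multipliers_of_shift_coordinates {ω₁ ω₂ : ℝ} (hω₁ : 0 ≤ ω₁) (hω : ω₁ < ω₂)
    (hω₂ : ω₂ ≤ Real.pi) (G : StateSpace ι) {E : Matrix ι (Fin n) ℝ} {F : Matrix (Fin n) ι ℝ}
    (hEF : E * F = 1) (hFE : F * E = 1) {a : Matrix Unit (Fin (n + 1)) ℝ}
    (ha : a () (Fin.last n) = 1) (hshift : E * tailSel n = G.A * (E * headSel n) + G.B * a)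
    {g : ℝ}
    (hbound : ∀ ω ∈ Set.Icc ω₁ ω₂, ∀ (x : ι → ℂ) (u : Unit → ℂ),
      Complex.exp (ω * Complex.I) • x = cplx G.A *ᵥ x + cplx G.B *ᵥ u →
      star (cplx G.C *ᵥ x + (G.D : ℂ) • u) ⬝ᵥ (cplx G.C *ᵥ x + (G.D : ℂ) • u)
        ≤ (g : ℂ) * (star u ⬝ᵥ u)) :
    ∃ X Y : Matrix ι ι ℝ, X.IsSymm ∧ Y.PosSemidef ∧
      (-(gkypMatrix G ω₁ ω₂ X Y g)).PosSemidef := by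
  set c : Matrix Unit (Fin (n + 1)) ℝ := G.C * (E * headSel n) + G.D • a with hc
  have hQ : (g • (aᵀ * a) - cᵀ * c).IsSymm := by
    simp [Matrix.IsSymm, Matrix.transpose_sub, Matrix.transpose_smul, Matrix.transpose_mul]
  -- By `hshift`, the vector `(1, z, …, zⁿ)` gives the trajectory `x = E (1, …, z^{n-1})`, `u = a
  -- (1, …, zⁿ)`, whose output is `c (1, …, zⁿ)`.
  obtain ⟨X₀, Y₀, hX₀, hY₀, hpos⟩ := exists_shift_multipliers hω₁ hω hω₂ hQ (fun ω hmem => by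
    have hz := hbound ω hmem (cplx (E * headSel n) *ᵥ powVec n (Complex.exp (ω * Complex.I)))
      (cplx a *ᵥ powVec n (Complex.exp (ω * Complex.I))) (by
        rw [Matrix.mulVec_mulVec, Matrix.mulVec_mulVec, ← Matrix.add_mulVec, ← cplx_mul,
          ← cplx_mul, ← cplx_add, ← hshift, cplx_mul, cplx_mul, ← Matrix.mulVec_mulVec,
          ← Matrix.mulVec_mulVec, ← Matrix.mulVec_smul]
        congr 1
        ext i
        simp [Matrix.mulVec, dotProduct, headSel, tailSel, cplx_apply, powVec, pow_succ',
          apply_ite])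
    rw [Matrix.mulVec_mulVec, ← Matrix.smul_mulVec, ← Matrix.add_mulVec, ← cplx_mul, ← cplx_smul,
      ← cplx_add, ← hc] at hz
    generalize powVec n (Complex.exp (ω * Complex.I)) = v at hz ⊢
    rw [cplx_sub, cplx_smul, cplx_mul, cplx_mul, ← conjTranspose_cplx, ← conjTranspose_cplx,
      Matrix.sub_mulVec, Matrix.smul_mulVec, ← Matrix.mulVec_mulVec, ← Matrix.mulVec_mulVec,
      dotProduct_sub, dotProduct_smul, Matrix.dotProduct_mulVec,
      Matrix.dotProduct_mulVec _ (cplx c)ᴴ,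
      ← Matrix.star_mulVec, ← Matrix.star_mulVec, smul_eq_mul]
    exact sub_nonneg.2 hz)
  set e : Matrix (Fin (n + 1)) Unit ℝ := Matrix.of fun i _ => if i = Fin.last n then 1 else 0
    with he
  have hhe : headSel n * e = 0 := by
    ext i j
    rw [headSel_mul_apply]
    simp [he, (Fin.castSucc_lt_last i).ne]
  have hae : a * e = 1 := by
    ext i j
    simp [he, Matrix.mul_apply, ha]
  have hht : headSel n * (headSel n)ᵀ = 1 := by
    ext i j
    rw [headSel_mul_apply]
    simp [headSel, Matrix.one_apply]
  -- `W` sends `(x, u, w)` to the vector `ξ` with head `F x` and `a ξ = u`. The last coordinate of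
  -- `ξ` is solvable because the last entry of `a` is `1`.
  set W : Matrix (Fin (n + 1)) ((ι ⊕ Unit) ⊕ Unit) ℝ :=
    (headSel n)ᵀ * (F * stateSel ι) + e * (inputSel ι - a * ((headSel n)ᵀ * (F * stateSel ι)))
    with hW
  have hhW : headSel n * W = F * stateSel ι := by
    rw [hW, Matrix.mul_add, ← Matrix.mul_assoc, hht, Matrix.one_mul, ← Matrix.mul_assoc, hhe,
      Matrix.zero_mul, add_zero]
  have haW : a * W = inputSel ι := by
    rw [hW, Matrix.mul_add, ← Matrix.mul_assoc a e, hae, Matrix.one_mul, add_sub_cancel]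
  have hEhW : E * headSel n * W = stateSel ι := by
    rw [Matrix.mul_assoc, hhW, ← Matrix.mul_assoc, hEF, Matrix.one_mul]
  have hnext : nextSel G.A G.B = G.A * stateSel ι + G.B * inputSel ι := by
    simp [nextSel, stateSel, inputSel, Matrix.mul_fromCols]
    ext i ((j | j) | j) <;> simp
  have houtput : outputSel G.C G.D = G.C * stateSel ι + G.D • inputSel ι := by
    simp [outputSel, stateSel, inputSel, Matrix.mul_fromCols]
    ext i ((j | j) | j) <;> simp
  have htW : tailSel n * W = F * nextSel G.A G.B := by
    have : E * (tailSel n * W) = nextSel G.A G.B := by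
      rw [← Matrix.mul_assoc, hshift, Matrix.add_mul, Matrix.mul_assoc, hEhW, Matrix.mul_assoc,
        haW, hnext]
    rw [← this, ← Matrix.mul_assoc, hFE, Matrix.one_mul]
  have hcW : c * W = outputSel G.C G.D := by
    rw [hc, Matrix.add_mul, Matrix.mul_assoc, hEhW, Matrix.smul_mul, haW, houtput]
  refine ⟨Fᵀ * X₀ * F, Fᵀ * Y₀ * F, ?_, ?_, ?_⟩
  · simp [Matrix.IsSymm, Matrix.transpose_mul, hX₀.eq, Matrix.mul_assoc]
  · have := hY₀.conjTranspose_mul_mul_same F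
    rwa [Matrix.conjTranspose_eq_transpose_of_trivial] at this
  · have h1 := hpos.conjTranspose_mul_mul_same (cplx W)
    have h2 := Matrix.posSemidef_conjTranspose_mul_self (cplx (residualSel G.C G.D))
    have hY₀' : Y₀ᵀ = Y₀ := by
      have := hY₀.1
      rwa [Matrix.IsHermitian, Matrix.conjTranspose_eq_transpose_of_trivial] at this
    -- `W` ignores `w`; the square of the residual accounts for all dependence on `w`.
    convert h1.add h2 using 1
    have hN : (cplx (nextSel G.A G.B))ᴴ * cplx (Fᵀ * X₀ * F) * cplx (nextSel G.A G.B)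
        = (cplx W)ᴴ * ((cplx (tailSel n))ᵀ * cplx X₀ * cplx (tailSel n)) * cplx W := by
      have : (cplx (nextSel G.A G.B))ᴴ * cplx (Fᵀ * X₀ * F) * cplx (nextSel G.A G.B)
        = (cplx (F * nextSel G.A G.B))ᴴ * cplx X₀ * cplx (F * nextSel G.A G.B) := by
        simp only [cplx_mul, ← conjTranspose_cplx, Matrix.conjTranspose_mul, Matrix.mul_assoc]
      rw [this, ← htW]
      simp only [cplx_mul, Matrix.conjTranspose_mul, Matrix.mul_assoc, conjTranspose_cplx,
        cplx_transpose]
    have hS : (cplx (stateSel ι))ᴴ * cplx (Fᵀ * X₀ * F) * cplx (stateSel ι)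
        = (cplx W)ᴴ * ((cplx (headSel n))ᵀ * cplx X₀ * cplx (headSel n)) * cplx W := by
      have : (cplx (stateSel ι))ᴴ * cplx (Fᵀ * X₀ * F) * cplx (stateSel ι)
        = (cplx (F * stateSel ι))ᴴ * cplx X₀ * cplx (F * stateSel ι) := by
        simp only [cplx_mul, ← conjTranspose_cplx, Matrix.conjTranspose_mul, Matrix.mul_assoc]
      rw [this, ← hhW]
      simp only [cplx_mul, Matrix.conjTranspose_mul, Matrix.mul_assoc, conjTranspose_cplx,
        cplx_transpose]
    have hB : bandTerm ((ω₁ + ω₂) / 2) ((ω₂ - ω₁) / 2) (cplx (stateSel ι)) (cplx (nextSel G.A G.B))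
          (cplx (Fᵀ * Y₀ * F))
        = (cplx W)ᴴ * bandTerm ((ω₁ + ω₂) / 2) ((ω₂ - ω₁) / 2) (cplx (headSel n))
          (cplx (tailSel n)) (cplx Y₀) * cplx W := by
      rw [cplx_mul, cplx_mul, ← conjTranspose_cplx, ← bandTerm_mul_left, ← cplx_mul, ← cplx_mul,
        ← hhW, ← htW, cplx_mul, cplx_mul, bandTerm_mul_right]
    rw [gkypMatrix_eq G ω₁ ω₂
      (by simp [Matrix.IsSymm, Matrix.transpose_mul, hX₀.eq, Matrix.mul_assoc])
      (by simp [Matrix.IsSymm, Matrix.transpose_mul, hY₀', Matrix.mul_assoc]), hN, hS, hB, ← haW,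
      ← hcW]
    simp only [cplx_sub, cplx_smul, cplx_mul, conjTranspose_cplx, cplx_transpose,
      Matrix.conjTranspose_mul, Matrix.mul_sub, Matrix.sub_mul, Matrix.mul_smul, Matrix.smul_mul,
      Matrix.mul_assoc]
    abel

end Necessity

/-! ### Shift coordinates of a controllable pair. -/

section ShiftCoordinates

open Polynomial

variable {ι : Type} [Fintype ι] [DecidableEq ι]

theorem coeff_iterate_divX (p : ℝ[X]) (k i : ℕ) : (divX^[k] p).coeff i = p.coeff (i + k) := by
  induction k generalizing i with
  | zero => simp
  | succ k ih => rw [Function.iterate_succ_apply', coeff_divX, ih]; congr 1; ring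

/-- The Horner vectors `β_k = χ_k(A) B`, with `χ_k` the polynomial part of `χ / X^k`, satisfy `β_k =
A β_{k+1} + (coeff of X^k in χ) B`. Here `β_0 = 0` by Cayley–Hamilton and `β_{n+1} = 0` by degree,
so `β_n = B`. The span of `β_1, …, β_n` contains `B` and is `A`-invariant, hence is everything by
controllability. The row `a` lists the coefficients of `χ`. -/
theorem exists_shift_coordinates {A : Matrix ι ι ℝ} {B : Matrix ι Unit ℝ}
    (h : IsControllable A B) :
    ∃ (E : Matrix ι (Fin (Fintype.card ι)) ℝ) (F : Matrix (Fin (Fintype.card ι)) ι ℝ)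
      (a : Matrix Unit (Fin (Fintype.card ι + 1)) ℝ), E * F = 1 ∧ F * E = 1 ∧
      a () (Fin.last _) = 1 ∧
      E * tailSel (Fintype.card ι) = A * (E * headSel (Fintype.card ι)) + B * a := by
  set n := Fintype.card ι with hn
  set β : ℕ → ι → ℝ := fun k => aeval A (divX^[k] A.charpoly) *ᵥ (fun i => B i ()) with hβ
  have hdeg : A.charpoly.natDegree = n := A.charpoly_natDegree_eq_dim
  have hlead : A.charpoly.coeff n = 1 := by rw [← hdeg]; exact A.charpoly_monic.coeff_natDegree
  have hβ0 : β 0 = 0 := by simp [hβ, Matrix.aeval_self_charpoly]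
  have hβlast : β (n + 1) = 0 := by
    have : divX^[n + 1] A.charpoly = 0 := by
      ext i
      rw [coeff_iterate_divX, coeff_zero]
      exact coeff_eq_zero_of_natDegree_lt (by omega)
    simp [hβ, this]
  have hβrec : ∀ k, β k = A *ᵥ β (k + 1) + A.charpoly.coeff k • (fun i => B i ()) := by
    intro k
    have h1 : divX^[k] A.charpoly
        = X * divX^[k + 1] A.charpoly + C (A.charpoly.coeff k) := by
      have := (X_mul_divX_add (divX^[k] A.charpoly)).symm
      rwa [coeff_iterate_divX, zero_add, ← Function.iterate_succ_apply' divX] at this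
    simp only [hβ]
    rw [h1, map_add, map_mul, aeval_X, aeval_C, Matrix.add_mulVec, ← Matrix.mulVec_mulVec,
      Algebra.algebraMap_eq_smul_one, Matrix.smul_mulVec, Matrix.one_mulVec]
  set E : Matrix ι (Fin n) ℝ := Matrix.of fun i k => β (k + 1) i with hE
  set S := Submodule.span ℝ (Set.range fun k : Fin n => β (k + 1)) with hS
  have hβS : ∀ k, k ≤ n → β k ∈ S := by
    rintro (_ | k) hk
    · rw [hβ0]; exact S.zero_mem
    · exact Submodule.subset_span ⟨⟨k, by omega⟩, rfl⟩
  have hBS : (fun i => B i ()) ∈ S := by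
    have := hβS n le_rfl
    rwa [hβrec n, hβlast, hlead, Matrix.mulVec_zero, zero_add, one_smul] at this
  have hAS : ∀ v ∈ S, A *ᵥ v ∈ S := by
    intro v hv
    have hle : S ≤ S.comap A.mulVecLin := by
      rw [hS, Submodule.span_le]
      rintro _ ⟨k, rfl⟩
      simp only [SetLike.mem_coe, Submodule.mem_comap, Matrix.mulVecLin_apply]
      rw [← add_sub_cancel_right (A *ᵥ β (k + 1)) (A.charpoly.coeff k • (fun i => B i ())),
        ← hβrec]
      exact S.sub_mem (hβS _ k.2.le) (S.smul_mem _ hBS)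
    exact hle hv
  have htop : S = ⊤ := by
    rw [eq_top_iff, ← h, Submodule.span_le]
    rintro _ ⟨k, rfl⟩
    have : ∀ k : ℕ, (fun i => (A ^ k * B) i ()) ∈ S := by
      intro k
      induction k with
      | zero => simpa using hBS
      | succ k ih =>
        have := hAS _ ih
        convert this using 1
        ext i
        rw [pow_succ', Matrix.mul_assoc]
        rfl
    exact this k
  have hF : ∀ i : ι, ∃ f : Fin n → ℝ, ∑ k, f k • β (k + 1) = Pi.single i 1 := fun i =>
    (Submodule.mem_span_range_iff_exists_fun ℝ).1 (by rw [← hS, htop]; trivial)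
  choose f hf using hF
  have hEF : E * (Matrix.of fun k i => f i k) = 1 := by
    ext i j
    have := congrFun (hf j) i
    simp only [Finset.sum_apply, Pi.smul_apply, smul_eq_mul] at this
    simp only [Matrix.mul_apply, hE, Matrix.of_apply, Matrix.one_apply]
    rw [Pi.single_apply] at this
    rw [← this]
    exact Finset.sum_congr rfl fun k _ => mul_comm _ _
  refine ⟨E, Matrix.of fun k i => f i k, Matrix.of fun _ k => A.charpoly.coeff k, hEF,
    (Matrix.mul_eq_one_comm_of_card_eq _ _ _ (by simp [hn])).1 hEF, by simpa using hlead, ?_⟩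
  have htail : ∀ i (k : Fin (n + 1)), (E * tailSel n) i k = β k i := by
    intro i k
    induction k using Fin.cases with
    | zero =>
      have h1 : ∀ j : Fin n, (0 : Fin (n + 1)) ≠ j.succ := fun j => (Fin.succ_ne_zero j).symm
      simp [Matrix.mul_apply, tailSel, h1, hβ0]
    | succ k => simp [Matrix.mul_apply, tailSel, hE]
  have hhead : ∀ i (k : Fin (n + 1)), (E * headSel n) i k = β (k + 1) i := by
    intro i k
    induction k using Fin.lastCases with
    | last =>
      have h1 : ∀ j : Fin n, Fin.last n ≠ j.castSucc := fun j => (Fin.castSucc_lt_last j).ne'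
      simp [Matrix.mul_apply, headSel, h1, hβlast]
    | cast k => simp [Matrix.mul_apply, headSel, hE]
  ext i k
  rw [htail, hβrec, Matrix.add_apply, Matrix.mul_apply]
  simp only [hhead]
  simp [Matrix.mul_apply, Matrix.mulVec, dotProduct, mul_comm]

end ShiftCoordinates

/-! ### Values of the KYP form on harmonic trajectories, and sufficiency. -/

section Forms

variable {ι κ μ : Type} [Fintype ι]

theorem conj_form [Fintype κ] [Fintype μ] (P : Matrix ι κ ℂ) (X : Matrix ι μ ℂ)
    (S : Matrix μ κ ℂ) (v : κ → ℂ) :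
    star v ⬝ᵥ ((Pᴴ * X * S) *ᵥ v) = star (P *ᵥ v) ⬝ᵥ (X *ᵥ (S *ᵥ v)) := by
  rw [Matrix.star_mulVec, ← Matrix.dotProduct_mulVec, Matrix.mulVec_mulVec, Matrix.mulVec_mulVec,
    Matrix.mul_assoc]

theorem gram_form [Fintype κ] (P S : Matrix ι κ ℂ) (v : κ → ℂ) :
    star v ⬝ᵥ ((Pᴴ * S) *ᵥ v) = star (P *ᵥ v) ⬝ᵥ (S *ᵥ v) := by
  rw [Matrix.star_mulVec, ← Matrix.dotProduct_mulVec, Matrix.mulVec_mulVec]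

theorem bandTerm_form [Fintype κ] (ω₀ r : ℝ) (P S : Matrix ι κ ℂ) (Y : Matrix ι ι ℂ) (v : κ → ℂ) :
    star v ⬝ᵥ (bandTerm ω₀ r P S Y *ᵥ v) =
      Complex.exp (-(ω₀ * Complex.I)) * (star (P *ᵥ v) ⬝ᵥ (Y *ᵥ (S *ᵥ v)))
        + Complex.exp (ω₀ * Complex.I) * (star (S *ᵥ v) ⬝ᵥ (Y *ᵥ (P *ᵥ v)))
        - (2 * Real.cos r : ℂ) * (star (P *ᵥ v) ⬝ᵥ (Y *ᵥ (P *ᵥ v))) := by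
  rw [bandTerm, Matrix.sub_mulVec, Matrix.add_mulVec, dotProduct_sub, dotProduct_add,
    Matrix.smul_mulVec, Matrix.smul_mulVec, Matrix.smul_mulVec, dotProduct_smul, dotProduct_smul,
    dotProduct_smul, conj_form, conj_form, conj_form]
  rfl

theorem bandTerm_isHermitian (ω₀ r : ℝ) (P S : Matrix ι κ ℂ) {Y : Matrix ι ι ℂ}
    (hY : Y.IsHermitian) : (bandTerm ω₀ r P S Y).IsHermitian := by
  have h1 : star (Complex.exp (-(ω₀ * Complex.I))) = Complex.exp (ω₀ * Complex.I) := by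
    rw [Complex.star_def, ← Complex.exp_conj]; simp
  have h2 : star (Complex.exp (ω₀ * Complex.I)) = Complex.exp (-(ω₀ * Complex.I)) := by
    rw [Complex.star_def, ← Complex.exp_conj]; simp
  have h3 : star (2 * Real.cos r : ℂ) = 2 * Real.cos r := by
    rw [← Complex.ofReal_ofNat, ← Complex.ofReal_mul]; exact Complex.conj_ofReal _
  simp only [Matrix.IsHermitian, bandTerm, Matrix.conjTranspose_sub, Matrix.conjTranspose_add,
    Matrix.conjTranspose_smul, Matrix.conjTranspose_mul, Matrix.conjTranspose_conjTranspose,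
    hY.eq, h1, h2, h3, Matrix.mul_assoc]
  abel

theorem cplx_isHermitian {κ : Type} {X : Matrix κ κ ℝ} (hX : X.IsSymm) : (cplx X).IsHermitian := by
  rw [Matrix.IsHermitian, conjTranspose_cplx, hX.eq]

theorem posSemidef_isSymm {κ : Type} {Y : Matrix κ κ ℝ} (hY : Y.PosSemidef) : Y.IsSymm := by
  have := hY.1
  rwa [Matrix.IsHermitian, Matrix.conjTranspose_eq_transpose_of_trivial] at this

theorem cplx_posSemidef {Y : Matrix ι ι ℝ} (hY : Y.PosSemidef) : (cplx Y).PosSemidef := by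
  have hH := cplx_isHermitian (posSemidef_isSymm hY)
  refine .of_dotProduct_mulVec_nonneg hH fun v => Complex.le_def.2 ⟨?_, ?_⟩
  · have h1 := hY.dotProduct_mulVec_nonneg (fun i => (v i).re)
    have h2 := hY.dotProduct_mulVec_nonneg (fun i => (v i).im)
    rw [Complex.zero_re]
    refine (add_nonneg h1 h2).trans_eq ?_
    simp only [dotProduct, Matrix.mulVec, Finset.mul_sum, ← Finset.sum_add_distrib, Complex.re_sum]
    refine Finset.sum_congr rfl fun i _ => Finset.sum_congr rfl fun j _ => ?_
    simp [cplx_apply]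
  · exact (hH.im_star_dotProduct_mulVec_self v).symm

end Forms

section Trajectories

variable {ι : Type} [Fintype ι]

theorem stateSel_mulVec [DecidableEq ι] (x : ι → ℂ) (u w : Unit → ℂ) :
    cplx (stateSel ι) *ᵥ Sum.elim (Sum.elim x u) w = x := by
  simp [stateSel, cplx_fromCols, cplx_one, cplx_zero]

theorem inputSel_mulVec (x : ι → ℂ) (u w : Unit → ℂ) :
    cplx (inputSel ι) *ᵥ Sum.elim (Sum.elim x u) w = u := by
  simp [inputSel, cplx_fromCols, cplx_one, cplx_zero]

theorem nextSel_mulVec (A : Matrix ι ι ℝ) (B : Matrix ι Unit ℝ) (x : ι → ℂ) (u w : Unit → ℂ) :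
    cplx (nextSel A B) *ᵥ Sum.elim (Sum.elim x u) w = cplx A *ᵥ x + cplx B *ᵥ u := by
  simp [nextSel, cplx_fromCols, cplx_zero]

theorem outputSel_mulVec (C : Matrix Unit ι ℝ) (D : ℝ) (x : ι → ℂ) (u w : Unit → ℂ) :
    cplx (outputSel C D) *ᵥ Sum.elim (Sum.elim x u) w = cplx C *ᵥ x + (D : ℂ) • u := by
  simp only [outputSel, cplx_fromCols, cplx_smul, cplx_one, cplx_zero, Matrix.fromCols_mulVec,
    Sum.elim_comp_inl, Sum.elim_comp_inr, Matrix.zero_mulVec, Matrix.smul_mulVec,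
    Matrix.one_mulVec, add_zero]

theorem residualSel_mulVec (C : Matrix Unit ι ℝ) (D : ℝ) (x : ι → ℂ) (u w : Unit → ℂ) :
    cplx (residualSel C D) *ᵥ Sum.elim (Sum.elim x u) w
      = cplx C *ᵥ x + (D : ℂ) • u - w := by
  simp only [residualSel, cplx_fromCols, cplx_smul, cplx_one, cplx_neg, Matrix.fromCols_mulVec,
    Sum.elim_comp_inl, Sum.elim_comp_inr, Matrix.neg_mulVec, Matrix.smul_mulVec,
    Matrix.one_mulVec, sub_eq_add_neg]

variable [DecidableEq ι]

/-- Value of the generalized KYP form on a harmonic trajectory. -/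
theorem gkyp_form_trajectory (G : StateSpace ι) (ω₁ ω₂ : ℝ) {X Y : Matrix ι ι ℝ} (hX : X.IsSymm)
    (hY : Y.IsSymm) (g ω : ℝ) {x : ι → ℂ} {u y : Unit → ℂ}
    (hx : Complex.exp (ω * Complex.I) • x = cplx G.A *ᵥ x + cplx G.B *ᵥ u)
    (hy : y = cplx G.C *ᵥ x + (G.D : ℂ) • u) :
    star (Sum.elim (Sum.elim x u) y) ⬝ᵥ
        (gkypMatrix G ω₁ ω₂ X Y g *ᵥ Sum.elim (Sum.elim x u) y)
      = ((2 * (Real.cos (ω - (ω₁ + ω₂) / 2) - Real.cos ((ω₂ - ω₁) / 2)) : ℝ) : ℂ)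
          * (star x ⬝ᵥ (cplx Y *ᵥ x)) - g * (star u ⬝ᵥ u) + star y ⬝ᵥ y := by
  rw [gkypMatrix_eq G ω₁ ω₂ hX hY]
  simp only [Matrix.sub_mulVec, Matrix.add_mulVec, dotProduct_sub, dotProduct_add,
    Matrix.smul_mulVec, dotProduct_smul, bandTerm_form]
  simp only [conj_form, gram_form, stateSel_mulVec, inputSel_mulVec, nextSel_mulVec,
    outputSel_mulVec, residualSel_mulVec, ← hx, ← hy, sub_self, star_zero, zero_dotProduct,
    Matrix.mulVec_smul, star_smul, smul_dotProduct, dotProduct_smul, smul_eq_mul, sub_zero]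
  -- `|z| = 1` cancels the two terms in `X`, and the two exponentials of the band term combine to `2
  -- cos (ω - ω₀)`.
  have hz : star (Complex.exp (ω * Complex.I)) * Complex.exp (ω * Complex.I) = 1 := by
    simpa using star_exp_pow_mul_exp_pow ω 1 1
  generalize star x ⬝ᵥ (cplx X *ᵥ x) = a
  generalize star x ⬝ᵥ (cplx Y *ᵥ x) = b
  have hcos : Complex.exp (-((((ω₁ + ω₂) / 2 : ℝ) : ℂ) * Complex.I)) * Complex.exp (ω * Complex.I)
      + Complex.exp ((((ω₁ + ω₂) / 2 : ℝ) : ℂ) * Complex.I) * star (Complex.exp (ω * Complex.I))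
      = 2 * (Real.cos (ω - (ω₁ + ω₂) / 2) : ℂ) := by
    rw [Complex.star_def, ← Complex.exp_conj, ← Complex.exp_add, ← Complex.exp_add,
      Complex.ofReal_cos, Complex.two_cos]
    congr 1 <;> congr 1 <;> simp <;> ring
  push_cast [-Complex.ofReal_cos] at hcos ⊢
  linear_combination a * hz + b * hcos

theorem cos_radius_le {ω₁ ω₂ ω : ℝ} (h : ω ∈ Set.Icc ω₁ ω₂) (hω : ω₂ - ω₁ ≤ 2 * Real.pi) :
    Real.cos ((ω₂ - ω₁) / 2) ≤ Real.cos (ω - (ω₁ + ω₂) / 2) := by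
  rw [← Real.cos_abs (ω - _)]
  refine Real.cos_le_cos_of_nonneg_of_le_pi (abs_nonneg _) (by linarith) (abs_le.2 ⟨?_, ?_⟩)
  · linarith [h.1]
  · linarith [h.2]

theorem bound_of_gkyp {G : StateSpace ι} {ω₁ ω₂ : ℝ} (hω : ω₂ - ω₁ ≤ 2 * Real.pi)
    {X Y : Matrix ι ι ℝ} (hX : X.IsSymm) (hY : Y.PosSemidef) {g : ℝ}
    (h : (-(gkypMatrix G ω₁ ω₂ X Y g)).PosSemidef) {ω : ℝ} (hmem : ω ∈ Set.Icc ω₁ ω₂)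
    {x : ι → ℂ} {u : Unit → ℂ}
    (hx : Complex.exp (ω * Complex.I) • x = cplx G.A *ᵥ x + cplx G.B *ᵥ u) :
    star (cplx G.C *ᵥ x + (G.D : ℂ) • u) ⬝ᵥ (cplx G.C *ᵥ x + (G.D : ℂ) • u)
      ≤ (g : ℂ) * (star u ⬝ᵥ u) := by
  have h1 := h.dotProduct_mulVec_nonneg
    (Sum.elim (Sum.elim x u) (cplx G.C *ᵥ x + (G.D : ℂ) • u))
  rw [Matrix.neg_mulVec, dotProduct_neg,
    gkyp_form_trajectory G ω₁ ω₂ hX (posSemidef_isSymm hY) g ω hx rfl] at h1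
  have h2 : (0 : ℂ) ≤ ((2 * (Real.cos (ω - (ω₁ + ω₂) / 2) - Real.cos ((ω₂ - ω₁) / 2)) : ℝ) : ℂ)
      * (star x ⬝ᵥ (cplx Y *ᵥ x)) :=
    mul_nonneg (by
      have := cos_radius_le hmem hω
      exact_mod_cast (by linarith :
        0 ≤ 2 * (Real.cos (ω - (ω₁ + ω₂) / 2) - Real.cos ((ω₂ - ω₁) / 2))))
      ((cplx_posSemidef hY).dotProduct_mulVec_nonneg x)
  rw [← sub_nonneg]
  convert add_nonneg h1 h2 using 1
  ring

theorem strict_bound_of_gkyp {G : StateSpace ι} {ω₁ ω₂ : ℝ} (hω : ω₂ - ω₁ ≤ 2 * Real.pi)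
    {X Y : Matrix ι ι ℝ} (hX : X.IsSymm) (hY : Y.PosSemidef) {g : ℝ}
    (h : (-(gkypMatrix G ω₁ ω₂ X Y g)).PosDef) {ω : ℝ} (hmem : ω ∈ Set.Icc ω₁ ω₂)
    {x : ι → ℂ} {u : Unit → ℂ} (hu : u ≠ 0)
    (hx : Complex.exp (ω * Complex.I) • x = cplx G.A *ᵥ x + cplx G.B *ᵥ u) :
    star (cplx G.C *ᵥ x + (G.D : ℂ) • u) ⬝ᵥ (cplx G.C *ᵥ x + (G.D : ℂ) • u)
      < (g : ℂ) * (star u ⬝ᵥ u) := by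
  have h1 := h.dotProduct_mulVec_pos
    (x := Sum.elim (Sum.elim x u) (cplx G.C *ᵥ x + (G.D : ℂ) • u)) (fun h0 => hu (by
      ext i
      exact congrFun h0 (Sum.inl (Sum.inr i))))
  rw [Matrix.neg_mulVec, dotProduct_neg,
    gkyp_form_trajectory G ω₁ ω₂ hX (posSemidef_isSymm hY) g ω hx rfl] at h1
  have h2 : (0 : ℂ) ≤ ((2 * (Real.cos (ω - (ω₁ + ω₂) / 2) - Real.cos ((ω₂ - ω₁) / 2)) : ℝ) : ℂ)
      * (star x ⬝ᵥ (cplx Y *ᵥ x)) :=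
    mul_nonneg (by
      have := cos_radius_le hmem hω
      exact_mod_cast (by linarith :
        0 ≤ 2 * (Real.cos (ω - (ω₁ + ω₂) / 2) - Real.cos ((ω₂ - ω₁) / 2))))
      ((cplx_posSemidef hY).dotProduct_mulVec_nonneg x)
  rw [← sub_pos]
  convert add_pos_of_pos_of_nonneg h1 h2 using 1
  ring

end Trajectories

/-! ### Perturbation to strict inequalities. -/

section Perturbation

variable {κ : Type} [Fintype κ]

theorem form_pos_iff {H : Matrix κ κ ℂ} (hH : H.IsHermitian) (v : κ → ℂ) :
    0 < star v ⬝ᵥ (H *ᵥ v) ↔ 0 < (star v ⬝ᵥ (H *ᵥ v)).re := by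
  rw [Complex.lt_def]
  simp only [Complex.zero_re, Complex.zero_im, and_iff_left_iff_imp]
  intro _
  exact (hH.im_star_dotProduct_mulVec_self v).symm

/-- Compactness of the unit sphere: where `H₁ ≤ 0`, the form `H₀` has a positive minimum `m`, and
`ε` is small enough that `ε H₁ ≥ -m/2`. Where `H₁ > 0`, nothing is lost. Homogeneity extends this to
all nonzero vectors. -/
theorem exists_add_smul_posDef {H₀ H₁ : Matrix κ κ ℂ} (h₀ : H₀.PosSemidef) (h₁ : H₁.IsHermitian)
    (h : ∀ v : κ → ℂ, v ≠ 0 → star v ⬝ᵥ (H₀ *ᵥ v) = 0 → 0 < star v ⬝ᵥ (H₁ *ᵥ v)) :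
    ∃ ε : ℝ, 0 < ε ∧ (H₀ + (ε : ℂ) • H₁).PosDef := by
  have hc : ∀ H : Matrix κ κ ℂ, Continuous fun v : κ → ℂ => (star v ⬝ᵥ (H *ᵥ v)).re := fun H =>
    Complex.continuous_re.comp
      (continuous_star.dotProduct (continuous_const.matrix_mulVec continuous_id))
  have hsph : IsCompact (Metric.sphere (0 : κ → ℂ) 1) := isCompact_sphere _ _
  have hne : ∀ v ∈ Metric.sphere (0 : κ → ℂ) 1, v ≠ 0 := by
    rintro v hv rfl
    simp at hv
  have hbad : IsCompact (Metric.sphere (0 : κ → ℂ) 1 ∩ {v | (star v ⬝ᵥ (H₁ *ᵥ v)).re ≤ 0}) :=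
    hsph.inter_right (isClosed_le (hc H₁) continuous_const)
  have hre0 : ∀ v, 0 ≤ (star v ⬝ᵥ (H₀ *ᵥ v)).re := fun v =>
    (Complex.le_def.1 (h₀.dotProduct_mulVec_nonneg v)).1
  obtain ⟨m, hm, hmle⟩ : ∃ m : ℝ, 0 < m ∧ ∀ v ∈ Metric.sphere (0 : κ → ℂ) 1,
      (star v ⬝ᵥ (H₁ *ᵥ v)).re ≤ 0 → m ≤ (star v ⬝ᵥ (H₀ *ᵥ v)).re := by
    rcases (Metric.sphere (0 : κ → ℂ) 1 ∩ {v | (star v ⬝ᵥ (H₁ *ᵥ v)).re ≤ 0}).eq_empty_or_nonempty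
      with he | hn
    · refine ⟨1, one_pos, fun v hv hv' => ?_⟩
      have : v ∈ (∅ : Set (κ → ℂ)) := he ▸ ⟨hv, hv'⟩
      exact this.elim
    · obtain ⟨w, ⟨hw, hw'⟩, hmin⟩ := hbad.exists_isMinOn hn (hc H₀).continuousOn
      refine ⟨_, lt_of_le_of_ne (hre0 w) fun h0 => ?_, fun v hv hv' => hmin ⟨hv, hv'⟩⟩
      have hz : star w ⬝ᵥ (H₀ *ᵥ w) = 0 :=
        Complex.ext h0.symm (h₀.isHermitian.im_star_dotProduct_mulVec_self w)
      have := (form_pos_iff h₁ w).1 (h w (hne w hw) hz)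
      exact absurd this (not_lt.2 hw')
  obtain ⟨b, hb⟩ := hsph.exists_bound_of_continuousOn (hc H₁).continuousOn
  set ε := m / (2 * (|b| + 1)) with hε
  have hb1 : 0 < |b| + 1 := by positivity
  have hεpos : 0 < ε := by positivity
  refine ⟨ε, hεpos, ?_⟩
  have hH : (H₀ + (ε : ℂ) • H₁).IsHermitian := by
    refine h₀.isHermitian.add ?_
    rw [Matrix.IsHermitian, Matrix.conjTranspose_smul, h₁.eq, Complex.star_def, Complex.conj_ofReal]
  have key : ∀ v ∈ Metric.sphere (0 : κ → ℂ) 1,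
      0 < (star v ⬝ᵥ ((H₀ + (ε : ℂ) • H₁) *ᵥ v)).re := by
    intro v hv
    rw [Matrix.add_mulVec, Matrix.smul_mulVec, dotProduct_add, dotProduct_smul, smul_eq_mul,
      Complex.add_re, Complex.re_ofReal_mul]
    by_cases hv' : (star v ⬝ᵥ (H₁ *ᵥ v)).re ≤ 0
    · have h1 := hmle v hv hv'
      have h2 := hb v hv
      rw [Real.norm_eq_abs] at h2
      have h3 : -(|b| + 1) ≤ (star v ⬝ᵥ (H₁ *ᵥ v)).re := by
        have := neg_abs_le (star v ⬝ᵥ (H₁ *ᵥ v)).re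
        have := le_abs_self b
        linarith
      have h4 : ε * (|b| + 1) = m / 2 := by rw [hε]; field_simp
      nlinarith
    · have := hre0 v
      push Not at hv'
      have := mul_pos hεpos hv'
      linarith
  refine .of_dotProduct_mulVec_pos hH fun v hv => (form_pos_iff hH v).2 ?_
  have hnv : 0 < ‖v‖ := norm_pos_iff.2 hv
  have hk := key ((‖v‖⁻¹ : ℂ) • v) (by
    rw [mem_sphere_zero_iff_norm, norm_smul, norm_inv, Complex.norm_real, norm_norm,
      inv_mul_cancel₀ hnv.ne'])
  rw [Matrix.mulVec_smul, star_smul, smul_dotProduct, dotProduct_smul, smul_eq_mul, smul_eq_mul,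
    ← mul_assoc, Complex.star_def, ← Complex.ofReal_inv, Complex.conj_ofReal, ← Complex.ofReal_mul,
    Complex.re_ofReal_mul] at hk
  exact (mul_pos_iff_of_pos_left (by positivity)).1 hk

end Perturbation

section Lyapunov

variable {ι : Type} [Fintype ι] [DecidableEq ι]

open scoped Matrix.Norms.L2Operator in
-- Gelfand's formula: the spectral radius is below `1`, hence so is some `‖M^K‖^{1/K}`.
theorem exists_pow_norm_lt_one {M : Matrix ι ι ℂ} (h : ∀ μ ∈ spectrum ℂ M, ‖μ‖ < 1) :
    ∃ K : ℕ, ‖M ^ K‖ < 1 := by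
  rcases isEmpty_or_nonempty ι with hι | hι
  · exact ⟨0, by rw [Subsingleton.elim (M ^ 0) 0]; simp⟩
  have hr : spectralRadius ℂ M < ((1 : NNReal) : ENNReal) :=
    spectrum.spectralRadius_lt_of_forall_lt M fun z hz => by
      have := h z hz
      exact_mod_cast this
  have hlim := spectrum.pow_nnnorm_pow_one_div_tendsto_nhds_spectralRadius M
  obtain ⟨K, hK, hK1⟩ := ((hlim.eventually_lt_const hr).and (Filter.eventually_ge_atTop 1)).exists
  refine ⟨K, ?_⟩
  by_contra hge
  push Not at hge
  have h1 : (1 : ENNReal) ≤ (‖M ^ K‖₊ : ENNReal) := by exact_mod_cast hge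
  have := ENNReal.one_le_rpow h1 (z := 1 / K) (by positivity)
  exact absurd hK (not_lt.2 (by simpa using this))

theorem cplx_pow (A : Matrix ι ι ℝ) (k : ℕ) : cplx (A ^ k) = cplx A ^ k := by
  induction k with
  | zero => simp [cplx_one]
  | succ k ih => rw [pow_succ, pow_succ, cplx_mul, ih]

theorem cplx_sum {κ : Type} (s : Finset ℕ) (f : ℕ → Matrix κ κ ℝ) :
    cplx (∑ k ∈ s, f k) = ∑ k ∈ s, cplx (f k) := by
  ext i j
  simp [cplx, Matrix.sum_apply]

theorem star_dotProduct_self_eq_norm_sq {κ : Type} [Fintype κ] (y : κ → ℂ) :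
    star y ⬝ᵥ y = ((‖WithLp.toLp 2 y‖ ^ 2 : ℝ) : ℂ) := by
  rw [EuclideanSpace.norm_sq_eq, Complex.ofReal_sum]
  simp only [dotProduct, Pi.star_apply]
  refine Finset.sum_congr rfl fun i _ => ?_
  rw [Complex.star_def, mul_comm, Complex.mul_conj, Complex.normSq_eq_norm_sq]

open scoped Matrix.Norms.L2Operator in
/-- A stable matrix admits a strict discrete Lyapunov matrix. -/
theorem exists_lyapunov {A : Matrix ι ι ℝ} (h : ∀ μ ∈ spectrum ℂ (cplx A), ‖μ‖ < 1) :
    ∃ X : Matrix ι ι ℝ, X.IsSymm ∧ ∀ x : ι → ℂ, x ≠ 0 →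
      0 < star x ⬝ᵥ (cplx X *ᵥ x) - star (cplx A *ᵥ x) ⬝ᵥ (cplx X *ᵥ (cplx A *ᵥ x)) := by
  obtain ⟨K, hK⟩ := exists_pow_norm_lt_one h
  -- A finite sum suffices: the Lyapunov difference telescopes to `‖x‖² - ‖A^K x‖²`, positive
  -- because `‖A^K‖ < 1`.
  refine ⟨∑ k ∈ Finset.range K, (A ^ k)ᵀ * A ^ k, ?_, fun x hx => ?_⟩
  · simp [Matrix.IsSymm, Matrix.transpose_sum, Matrix.transpose_mul]
  · have hform : ∀ y : ι → ℂ, star y ⬝ᵥ (cplx (∑ k ∈ Finset.range K, (A ^ k)ᵀ * A ^ k) *ᵥ y)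
        = ∑ k ∈ Finset.range K, star (cplx A ^ k *ᵥ y) ⬝ᵥ (cplx A ^ k *ᵥ y) := by
      intro y
      have hsum : cplx (∑ k ∈ Finset.range K, (A ^ k)ᵀ * A ^ k)
          = ∑ k ∈ Finset.range K, (cplx A ^ k)ᴴ * cplx A ^ k := by
        rw [cplx_sum]
        exact Finset.sum_congr rfl fun k _ => by
          rw [cplx_mul, ← conjTranspose_cplx, cplx_pow]
      rw [hsum, Matrix.sum_mulVec, dotProduct_sum]
      exact Finset.sum_congr rfl fun k _ => gram_form _ _ _
    rw [hform, hform, ← Finset.sum_sub_distrib]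
    simp only [Matrix.mulVec_mulVec, ← pow_succ]
    rw [Finset.sum_range_sub' (fun k => star (cplx A ^ k *ᵥ x) ⬝ᵥ (cplx A ^ k *ᵥ x)), pow_zero,
      Matrix.one_mulVec, sub_pos,
      star_dotProduct_self_eq_norm_sq, star_dotProduct_self_eq_norm_sq, Complex.real_lt_real]
    have h1 := Matrix.l2_opNorm_mulVec (cplx A ^ K) (WithLp.toLp 2 x)
    have h2 : 0 < ‖WithLp.toLp 2 x‖ := by
      rw [norm_pos_iff]
      intro h0
      exact hx (by simpa using congrArg WithLp.ofLp h0)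
    have h3 : ‖WithLp.toLp 2 (cplx A ^ K *ᵥ x)‖ < ‖WithLp.toLp 2 x‖ :=
      lt_of_le_of_lt h1 (mul_lt_of_lt_one_left h2 hK)
    exact pow_lt_pow_left₀ h3 (norm_nonneg _) two_ne_zero

/-- A feasible point of the generalized KYP inequality can be perturbed to a strictly feasible one
at any strictly larger level. -/
theorem exists_strict_multipliers {G : StateSpace ι} (hA : ∀ μ ∈ spectrum ℂ (cplx G.A), ‖μ‖ < 1)
    {ω₁ ω₂ : ℝ} {X Y : Matrix ι ι ℝ} (hX : X.IsSymm) (hY : Y.PosSemidef) {g g' : ℝ} (hg : g < g')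
    (h : (-(gkypMatrix G ω₁ ω₂ X Y g)).PosSemidef) :
    ∃ X' Y' : Matrix ι ι ℝ, X'.IsSymm ∧ Y'.PosDef ∧
      (-(gkypMatrix G ω₁ ω₂ X' Y' g')).PosDef := by
  obtain ⟨Z, hZ, hpos⟩ := exists_lyapunov hA
  have hYs := posSemidef_isSymm hY
  have hI : ((((g' - g : ℝ) : ℂ)) • ((cplx (inputSel ι))ᴴ * cplx (inputSel ι))).PosSemidef :=
    (Matrix.posSemidef_conjTranspose_mul_self _).smul (by exact_mod_cast (sub_pos.2 hg).le)
  have hZ' := cplx_isHermitian hZ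
  have hH₁ : ((cplx (stateSel ι))ᴴ * cplx Z * cplx (stateSel ι)
      - (cplx (nextSel G.A G.B))ᴴ * cplx Z * cplx (nextSel G.A G.B)).IsHermitian :=
    (Matrix.isHermitian_conjTranspose_mul_mul _ hZ').sub
      (Matrix.isHermitian_conjTranspose_mul_mul _ hZ')
  -- A null vector of the form relaxed to level `g'` has `u = 0`, and there the Lyapunov form is
  -- positive if `x ≠ 0`. If `x = 0` as well, the form reduces to `|w|²`, forcing `w = 0`.
  obtain ⟨ε, -, hε⟩ := exists_add_smul_posDef (h.add hI) hH₁ (fun v hv hv0 => by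
    obtain ⟨x, u, w, rfl⟩ : ∃ x u w, v = Sum.elim (Sum.elim x u) w :=
      ⟨v ∘ Sum.inl ∘ Sum.inl, v ∘ Sum.inl ∘ Sum.inr, v ∘ Sum.inr, by
        ext ((i | i) | i) <;> rfl⟩
    rw [Matrix.add_mulVec, dotProduct_add] at hv0
    obtain ⟨hv1, hv2⟩ := (add_eq_zero_iff_of_nonneg (h.dotProduct_mulVec_nonneg _)
      (hI.dotProduct_mulVec_nonneg _)).1 hv0
    have hu : u = 0 := by
      rw [Matrix.smul_mulVec, dotProduct_smul, gram_form, inputSel_mulVec, smul_eq_mul,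
        mul_eq_zero] at hv2
      rcases hv2 with h0 | h0
      · exact absurd (by exact_mod_cast h0) (sub_pos.2 hg).ne'
      · exact dotProduct_star_self_eq_zero.1 h0
    subst hu
    rw [Matrix.sub_mulVec, dotProduct_sub, conj_form, conj_form, stateSel_mulVec, nextSel_mulVec,
      Matrix.mulVec_zero, add_zero]
    refine hpos x ?_
    rintro rfl
    rw [gkypMatrix_eq G ω₁ ω₂ hX hYs] at hv1
    simp only [Matrix.neg_mulVec, Matrix.sub_mulVec, Matrix.add_mulVec, dotProduct_neg,
      dotProduct_sub, dotProduct_add, Matrix.smul_mulVec, dotProduct_smul, bandTerm_form] at hv1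
    simp only [conj_form, gram_form, stateSel_mulVec, inputSel_mulVec, nextSel_mulVec,
      outputSel_mulVec, residualSel_mulVec, Matrix.mulVec_zero, dotProduct_zero, star_zero,
      smul_zero, mul_zero, add_zero, sub_zero, zero_sub, neg_neg, star_neg, neg_dotProduct_neg]
      at hv1
    apply hv
    rw [dotProduct_star_self_eq_zero.1 hv1]
    ext ((i | i) | i) <;> rfl)
  -- Positive definiteness is an open condition, so `Y` can be moved into the interior of the cone.
  obtain ⟨η, hη, hηpos⟩ := exists_add_smul_posDef hε.posSemidef
    (bandTerm_isHermitian ((ω₁ + ω₂) / 2) ((ω₂ - ω₁) / 2) (cplx (stateSel ι))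
      (cplx (nextSel G.A G.B)) (Matrix.isHermitian_one (n := ι) (α := ℂ))).neg
    (fun v hv hv0 => absurd hv0 (hε.dotProduct_mulVec_pos hv).ne')
  refine ⟨X + ε • Z, Y + η • 1, hX.add (hZ.smul ε),
    Matrix.PosDef.posSemidef_add hY (Matrix.PosDef.one.smul hη), ?_⟩
  convert hηpos using 1
  rw [gkypMatrix_eq G ω₁ ω₂ hX hYs, gkypMatrix_eq G ω₁ ω₂ (hX.add (hZ.smul ε))
    (hYs.add (Matrix.isSymm_one.smul η))]
  simp only [cplx_add, cplx_smul, cplx_one, bandTerm_add, bandTerm_smul, Matrix.mul_add,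
    Matrix.add_mul, Matrix.mul_smul, Matrix.smul_mul, Complex.ofReal_sub, smul_neg, smul_sub]
  module

end Lyapunov

/-! ### Stability, transfer functions and the augmented realization. -/

section Spectrum

variable {ι : Type} [Fintype ι] [DecidableEq ι]

theorem mem_spectrum_iff_exists_mulVec {M : Matrix ι ι ℂ} {μ : ℂ} :
    μ ∈ spectrum ℂ M ↔ ∃ v ≠ 0, M *ᵥ v = μ • v := by
  rw [spectrum.mem_iff, Matrix.isUnit_iff_isUnit_det, isUnit_iff_ne_zero, not_not,
    ← Matrix.exists_mulVec_eq_zero_iff]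
  refine exists_congr fun v => and_congr_right fun _ => ?_
  rw [Matrix.sub_mulVec, sub_eq_zero, Algebra.algebraMap_eq_smul_one, Matrix.smul_mulVec,
    Matrix.one_mulVec, eq_comm]

theorem StateSpace.IsStable.det_ne_zero {G : StateSpace ι} (hG : G.IsStable) {z : ℂ}
    (hz : 1 ≤ ‖z‖) : (z • (1 : Matrix ι ι ℂ) - cplx G.A).det ≠ 0 := by
  have : z ∉ spectrum ℂ (cplx G.A) := fun h => absurd (hG z h) (not_lt.2 hz)
  rw [spectrum.mem_iff, not_not, Matrix.isUnit_iff_isUnit_det, isUnit_iff_ne_zero,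
    Algebra.algebraMap_eq_smul_one] at this
  exact this

theorem StateSpace.IsStable.exists_state {G : StateSpace ι} (hG : G.IsStable) {z : ℂ}
    (hz : 1 ≤ ‖z‖) : ∃ x : ι → ℂ, z • x = cplx G.A *ᵥ x + cplx G.B *ᵥ 1 ∧
      G.transfer z = (cplx G.C *ᵥ x) () + G.D := by
  refine ⟨(z • (1 : Matrix ι ι ℂ) - cplx G.A)⁻¹ *ᵥ (cplx G.B *ᵥ 1), ?_, ?_⟩
  · rw [← sub_eq_iff_eq_add', ← Matrix.one_mulVec (z • _), Matrix.mulVec_smul,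
      ← Matrix.smul_mulVec, ← Matrix.sub_mulVec, Matrix.mulVec_mulVec,
      Matrix.mul_nonsing_inv _ (isUnit_iff_ne_zero.2 (hG.det_ne_zero hz)), Matrix.one_mulVec]
  · rw [StateSpace.transfer, Matrix.mulVec_mulVec, Matrix.mulVec_mulVec]
    simp [Matrix.mulVec, dotProduct]

theorem StateSpace.IsStable.continuous_transfer {G : StateSpace ι} (hG : G.IsStable) :
    Continuous fun ω : ℝ => G.transfer (Complex.exp (ω * Complex.I)) := by
  have hM : Continuous fun ω : ℝ =>
      Complex.exp (ω * Complex.I) • (1 : Matrix ι ι ℂ) - cplx G.A := by fun_prop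
  have hinv : Continuous fun ω : ℝ =>
      (Complex.exp (ω * Complex.I) • (1 : Matrix ι ι ℂ) - cplx G.A)⁻¹ := by
    simp only [Matrix.inv_def, Ring.inverse_eq_inv']
    exact (hM.matrix_det.inv₀ fun ω => hG.det_ne_zero (by rw [Complex.norm_exp_ofReal_mul_I])).smul
      hM.matrix_adjugate
  unfold StateSpace.transfer
  exact (((continuous_const.matrix_mul hinv).matrix_mul continuous_const).matrix_elem () ()).add
    continuous_const

end Spectrum

section Augmented

variable {n₁ n₂ N : ℕ}

theorem firA_mulVec (y : Fin N → ℂ) (i : Fin N) :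
    (cplx (firA N) *ᵥ y) i = if h : (i : ℕ) + 1 < N then y ⟨i + 1, h⟩ else 0 := by
  simp only [Matrix.mulVec, dotProduct, cplx_apply, firA, Matrix.of_apply]
  split_ifs with h
  · rw [Finset.sum_eq_single ⟨i + 1, h⟩]
    · simp
    · intro j _ hj
      rw [if_neg (fun h' => hj (Fin.ext h'))]
      simp
    · simp
  · refine Finset.sum_eq_zero fun j _ => ?_
    rw [if_neg (by have := j.2; omega)]
    simp

theorem augA_mulVec (G₁ : StateSpace (Fin n₁)) (G₂ : StateSpace (Fin n₂)) (x₁ : Fin n₁ → ℂ)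
    (x₂ : Fin n₂ → ℂ) (y : Fin N → ℂ) :
    cplx (augA N G₁ G₂) *ᵥ Sum.elim x₁ (Sum.elim x₂ y) =
      Sum.elim (cplx G₁.A *ᵥ x₁) (Sum.elim (cplx G₂.A *ᵥ x₂)
        (cplx (firB N) *ᵥ (cplx G₂.C *ᵥ x₂) + cplx (firA N) *ᵥ y)) := by
  have hblock : ∀ {m n k l : Type} (A : Matrix m k ℝ) (B : Matrix m l ℝ) (C : Matrix n k ℝ)
      (D : Matrix n l ℝ), cplx (Matrix.fromBlocks A B C D)
        = Matrix.fromBlocks (cplx A) (cplx B) (cplx C) (cplx D) := fun A B C D =>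
    Matrix.fromBlocks_map ..
  rw [augA, hblock, hblock]
  simp [Matrix.fromBlocks_mulVec, cplx_zero, cplx_mul]

theorem augB_mulVec (G₁ : StateSpace (Fin n₁)) (G₂ : StateSpace (Fin n₂)) (u : Unit → ℂ) :
    cplx (augB N G₁ G₂) *ᵥ u =
      Sum.elim (cplx G₁.B *ᵥ u) (Sum.elim (cplx G₂.B *ᵥ u)
        (cplx (firB N) *ᵥ ((G₂.D : ℂ) • u))) := by
  have hrows : ∀ {m n k : Type} (A : Matrix m k ℝ) (B : Matrix n k ℝ),
      cplx (Matrix.fromRows A B) = Matrix.fromRows (cplx A) (cplx B) := fun A B => by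
    ext (i | i) j <;> rfl
  rw [augB, hrows, hrows, cplx_smul, Matrix.fromRows_mulVec, Matrix.fromRows_mulVec,
    Matrix.smul_mulVec, Matrix.mulVec_smul]

theorem firB_mulVec (u : Unit → ℂ) (i : Fin N) :
    (cplx (firB N) *ᵥ u) i = if (i : ℕ) + 1 = N then u () else 0 := by
  simp only [Matrix.mulVec, dotProduct, cplx_apply, firB, Matrix.of_apply]
  split_ifs <;> simp [*]

/-- The state matrix is block triangular with diagonal blocks `A₁`, `A₂` and a nilpotent shift, so
its eigenvalues are those of `A₁` and `A₂`, and possibly `0`. -/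
theorem augmented_isStable {G₁ : StateSpace (Fin n₁)} {G₂ : StateSpace (Fin n₂)}
    (hG₁ : G₁.IsStable) (hG₂ : G₂.IsStable) (α : Fin (N + 1) → ℝ) :
    (augmented G₁ G₂ α).IsStable := by
  intro μ hμ
  obtain ⟨v, hv, hμv⟩ := mem_spectrum_iff_exists_mulVec.1 hμ
  obtain ⟨x₁, x₂, y, rfl⟩ : ∃ x₁ x₂ y, v = Sum.elim x₁ (Sum.elim x₂ y) :=
    ⟨v ∘ Sum.inl, v ∘ Sum.inr ∘ Sum.inl, v ∘ Sum.inr ∘ Sum.inr, by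
      ext (i | i | i) <;> rfl⟩
  rw [show (augmented G₁ G₂ α).A = augA N G₁ G₂ from rfl, augA_mulVec] at hμv
  have e₁ : cplx G₁.A *ᵥ x₁ = μ • x₁ := funext fun i => congrFun hμv (Sum.inl i)
  have e₂ : cplx G₂.A *ᵥ x₂ = μ • x₂ := funext fun i => congrFun hμv (Sum.inr (Sum.inl i))
  have e₃ : cplx (firB N) *ᵥ (cplx G₂.C *ᵥ x₂) + cplx (firA N) *ᵥ y = μ • y :=
    funext fun i => congrFun hμv (Sum.inr (Sum.inr i))
  by_cases h₁ : x₁ = 0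
  swap
  · exact hG₁ μ (mem_spectrum_iff_exists_mulVec.2 ⟨x₁, h₁, e₁⟩)
  by_cases h₂ : x₂ = 0
  swap
  · exact hG₂ μ (mem_spectrum_iff_exists_mulVec.2 ⟨x₂, h₂, e₂⟩)
  by_cases hμ0 : μ = 0
  · simp [hμ0]
  exfalso
  subst h₁ h₂
  rw [Matrix.mulVec_zero, Matrix.mulVec_zero, zero_add] at e₃
  -- For `μ ≠ 0` the entries of `y` vanish from the end of the register backwards; `d` bounds the
  -- distance from the last entry.
  have hy : ∀ d : ℕ, ∀ i : Fin N, N ≤ i + 1 + d → y i = 0 := by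
    intro d
    induction d with
    | zero =>
      intro i hi
      have := congrFun e₃ i
      rw [firA_mulVec, dif_neg (by omega), Pi.smul_apply, smul_eq_mul, eq_comm, mul_eq_zero] at this
      exact this.resolve_left hμ0
    | succ d ih =>
      intro i hi
      have := congrFun e₃ i
      rw [firA_mulVec] at this
      split_ifs at this with h
      · rw [ih ⟨i + 1, h⟩ (by simp only []; omega), Pi.smul_apply, smul_eq_mul, eq_comm,
          mul_eq_zero] at this
        exact this.resolve_left hμ0
      · exact ih i (by omega)
  apply hv
  have : y = 0 := funext fun i => hy N i (by omega)
  subst this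
  ext (i | i | i) <;> rfl

/-- The harmonic response of the augmented realization is `T₁ + Q T₂`. -/
theorem exists_augmented_state {G₁ : StateSpace (Fin n₁)} {G₂ : StateSpace (Fin n₂)}
    (hG₁ : G₁.IsStable) (hG₂ : G₂.IsStable) (α : Fin (N + 1) → ℝ) {z : ℂ} (hz : 1 ≤ ‖z‖) :
    ∃ x : Fin n₁ ⊕ (Fin n₂ ⊕ Fin N) → ℂ,
      z • x = cplx (augmented G₁ G₂ α).A *ᵥ x + cplx (augmented G₁ G₂ α).B *ᵥ 1 ∧
      (cplx (augmented G₁ G₂ α).C *ᵥ x) () + (augmented G₁ G₂ α).D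
        = G₁.transfer z + firTransfer α z * G₂.transfer z := by
  have hz0 : z ≠ 0 := by
    rintro rfl
    simp at hz
    linarith
  obtain ⟨x₁, h₁, t₁⟩ := hG₁.exists_state hz
  obtain ⟨x₂, h₂, t₂⟩ := hG₂.exists_state hz
  -- Entry `j` of the register holds the output of `T₂` delayed by `N - j` steps.
  refine ⟨Sum.elim x₁ (Sum.elim x₂ fun j => z⁻¹ ^ (N - (j : ℕ)) * G₂.transfer z), ?_, ?_⟩
  · rw [show (augmented G₁ G₂ α).A = augA N G₁ G₂ from rfl,
      show (augmented G₁ G₂ α).B = augB N G₁ G₂ from rfl, augA_mulVec, augB_mulVec]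
    ext (i | i | i)
    · exact congrFun h₁ i
    · exact congrFun h₂ i
    · simp only [Pi.smul_apply, Sum.elim_inr, Pi.add_apply, firB_mulVec, firA_mulVec, smul_eq_mul,
        Pi.one_apply, mul_one]
      have hi := i.2
      split_ifs with h1 h2 h2
      · omega
      · rw [show N - (i : ℕ) = 1 by omega, t₂]
        field_simp
        ring
      · rw [show N - (i : ℕ) = N - (i + 1) + 1 by omega, pow_succ]
        field_simp
        ring
      · omega
  · have hC : (cplx (augmented G₁ G₂ α).C *ᵥ
        Sum.elim x₁ (Sum.elim x₂ fun j => z⁻¹ ^ (N - (j : ℕ)) * G₂.transfer z)) ()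
        = (cplx G₁.C *ᵥ x₁) () + ((α 0 : ℂ) * (cplx G₂.C *ᵥ x₂) ()
          + (cplx (firC α) *ᵥ fun j => z⁻¹ ^ (N - (j : ℕ)) * G₂.transfer z) ()) := by
      simp only [augmented, cplx_fromCols, cplx_smul, Matrix.fromCols_mulVec, Sum.elim_comp_inl,
        Sum.elim_comp_inr, Matrix.smul_mulVec, Pi.add_apply, Pi.smul_apply, smul_eq_mul]
    have hfir : (cplx (firC α) *ᵥ fun j => z⁻¹ ^ (N - (j : ℕ)) * G₂.transfer z) ()
        = (∑ i : Fin N, (α i.succ : ℂ) * z⁻¹ ^ (i.succ : ℕ)) * G₂.transfer z := by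
      rw [Finset.sum_mul, ← Equiv.sum_comp Fin.revPerm]
      simp only [Matrix.mulVec, dotProduct, cplx_apply, firC, Matrix.of_apply]
      refine Finset.sum_congr rfl fun j _ => ?_
      have hj : ((Fin.revPerm j).succ : ℕ) = N - j := by
        simp [Fin.val_rev]
        omega
      have hj' : (Fin.revPerm j).succ = ⟨N - (j : ℕ), by omega⟩ := Fin.ext hj
      rw [hj, hj', mul_assoc]
    rw [hC, hfir, firTransfer, Fin.sum_univ_succ, show (augmented G₁ G₂ α).D = G₁.D + α 0 * G₂.D
      from rfl, t₁, t₂]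
    push_cast
    simp only [Fin.val_zero, pow_zero]
    ring

end Augmented

/-! ### The matrix inequalities and the semidefinite program. -/

section Design

variable {n₁ n₂ N : ℕ}

theorem designGain_isGreatest {G₁ : StateSpace (Fin n₁)} {G₂ : StateSpace (Fin n₂)}
    (hG₁ : G₁.IsStable) (hG₂ : G₂.IsStable) {ω₁ ω₂ : ℝ} (hω : ω₁ < ω₂)
    (α : Fin (N + 1) → ℝ) :
    IsGreatest
      ((fun ω : ℝ =>
        ‖G₁.transfer (Complex.exp (ω * Complex.I))
          + firTransfer α (Complex.exp (ω * Complex.I))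
            * G₂.transfer (Complex.exp (ω * Complex.I))‖) '' Set.Icc ω₁ ω₂)
      (designGain G₁ G₂ ω₁ ω₂ α) := by
  have hfir : Continuous fun ω : ℝ => firTransfer α (Complex.exp (ω * Complex.I)) := by
    unfold firTransfer
    refine continuous_finsetSum _ fun i _ => continuous_const.mul (Continuous.pow ?_ _)
    exact Continuous.inv₀ (by fun_prop) fun ω => Complex.exp_ne_zero _
  have hcont := (hG₁.continuous_transfer.add (hfir.mul hG₂.continuous_transfer)).norm
  obtain ⟨w, hw, hmax⟩ := isCompact_Icc.exists_isMaxOn (Set.nonempty_Icc.2 hω.le)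
    hcont.continuousOn
  have hgr : IsGreatest ((fun ω : ℝ =>
        ‖G₁.transfer (Complex.exp (ω * Complex.I))
          + firTransfer α (Complex.exp (ω * Complex.I))
            * G₂.transfer (Complex.exp (ω * Complex.I))‖) '' Set.Icc ω₁ ω₂) _ :=
    ⟨⟨w, hw, rfl⟩, by rintro _ ⟨ω, hω', rfl⟩; exact hmax hω'⟩
  have : designGain G₁ G₂ ω₁ ω₂ α = _ := hgr.csSup_eq
  rw [this]
  exact hgr

theorem designGain_nonneg {G₁ : StateSpace (Fin n₁)} {G₂ : StateSpace (Fin n₂)}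
    (hG₁ : G₁.IsStable) (hG₂ : G₂.IsStable) {ω₁ ω₂ : ℝ} (hω : ω₁ < ω₂)
    (α : Fin (N + 1) → ℝ) : 0 ≤ designGain G₁ G₂ ω₁ ω₂ α := by
  obtain ⟨ω, -, h⟩ := (designGain_isGreatest hG₁ hG₂ hω α).1
  rw [← h]
  exact norm_nonneg _

theorem unit_form_eq (y : Unit → ℂ) : star y ⬝ᵥ y = ((‖y ()‖ ^ 2 : ℝ) : ℂ) := by
  simp [dotProduct, mul_comm, Complex.mul_conj, Complex.normSq_eq_norm_sq]

/-- Outside the open unit disc `z` is not an eigenvalue, so `u` determines `x`: every harmonic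
trajectory is a scalar multiple of the one with unit input. -/
theorem augmented_output_eq {G₁ : StateSpace (Fin n₁)} {G₂ : StateSpace (Fin n₂)}
    (hG₁ : G₁.IsStable) (hG₂ : G₂.IsStable) (α : Fin (N + 1) → ℝ) {z : ℂ} (hz : 1 ≤ ‖z‖)
    {x : Fin n₁ ⊕ (Fin n₂ ⊕ Fin N) → ℂ} {u : Unit → ℂ}
    (hx : z • x = cplx (augmented G₁ G₂ α).A *ᵥ x + cplx (augmented G₁ G₂ α).B *ᵥ u) :
    (cplx (augmented G₁ G₂ α).C *ᵥ x + ((augmented G₁ G₂ α).D : ℂ) • u) ()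
      = (G₁.transfer z + firTransfer α z * G₂.transfer z) * u () := by
  obtain ⟨x₀, h₀, t₀⟩ := exists_augmented_state hG₁ hG₂ α hz
  have hu : u = u () • 1 := by ext; simp
  have hxx : x = u () • x₀ := by
    rw [← sub_eq_zero]
    by_contra hne
    refine absurd (augmented_isStable hG₁ hG₂ α z
      (mem_spectrum_iff_exists_mulVec.2 ⟨_, hne, ?_⟩)) (not_lt.2 hz)
    rw [Matrix.mulVec_sub, Matrix.mulVec_smul, smul_sub, hx, smul_comm z, h₀, smul_add,
      ← Matrix.mulVec_smul _ _ (1 : Unit → ℂ), ← hu]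
    abel
  rw [← t₀, hxx, Matrix.mulVec_smul]
  simp
  ring

/-- The level is an arbitrary real `g` because it is a free variable of the semidefinite program. -/
theorem lmi_iff {G₁ : StateSpace (Fin n₁)} {G₂ : StateSpace (Fin n₂)}
    (hG₁ : G₁.IsStable) (hG₂ : G₂.IsStable)
    (hctrl : IsControllable (augA N G₁ G₂) (augB N G₁ G₂)) {ω₁ ω₂ : ℝ} (hω₁ : 0 ≤ ω₁)
    (hω : ω₁ < ω₂) (hω₂ : ω₂ ≤ Real.pi) (α : Fin (N + 1) → ℝ) (g : ℝ) :
    (∃ X Y : Matrix (Fin n₁ ⊕ (Fin n₂ ⊕ Fin N)) (Fin n₁ ⊕ (Fin n₂ ⊕ Fin N)) ℝ,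
      X.IsSymm ∧ Y.PosSemidef ∧
        (-(gkypMatrix (augmented G₁ G₂ α) ω₁ ω₂ X Y g)).PosSemidef) ↔
      designGain G₁ G₂ ω₁ ω₂ α ^ 2 ≤ g := by
  have hgr := designGain_isGreatest hG₁ hG₂ hω α
  have hn : ∀ ω : ℝ, 1 ≤ ‖Complex.exp (ω * Complex.I)‖ := fun ω => by
    rw [Complex.norm_exp_ofReal_mul_I]
  constructor
  · rintro ⟨X, Y, hX, hY, h⟩
    obtain ⟨ω, hmem, hval⟩ := hgr.1
    obtain ⟨x, hx, -⟩ := exists_augmented_state hG₁ hG₂ α (hn ω)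
    have := bound_of_gkyp (by linarith) hX hY h hmem hx
    rw [unit_form_eq, augmented_output_eq hG₁ hG₂ α (hn ω) hx, unit_form_eq,
      ← Complex.ofReal_mul, Complex.real_le_real] at this
    simpa [← hval] using this
  · intro hle
    obtain ⟨E, F, a, hEF, hFE, ha, hshift⟩ := exists_shift_coordinates hctrl
    refine exists_multipliers_of_shift_coordinates hω₁ hω hω₂ (augmented G₁ G₂ α) hEF hFE ha
      hshift fun ω hmem x u hx => ?_
    rw [unit_form_eq, augmented_output_eq hG₁ hG₂ α (hn ω) hx, unit_form_eq,
      ← Complex.ofReal_mul, Complex.real_le_real, norm_mul, mul_pow]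
    refine mul_le_mul_of_nonneg_right (le_trans ?_ hle) (by positivity)
    exact pow_le_pow_left₀ (norm_nonneg _) (hgr.2 ⟨ω, hmem, rfl⟩) 2

theorem strict_lmi_iff {G₁ : StateSpace (Fin n₁)} {G₂ : StateSpace (Fin n₂)}
    (hG₁ : G₁.IsStable) (hG₂ : G₂.IsStable)
    (hctrl : IsControllable (augA N G₁ G₂) (augB N G₁ G₂)) {ω₁ ω₂ : ℝ} (hω₁ : 0 ≤ ω₁)
    (hω : ω₁ < ω₂) (hω₂ : ω₂ ≤ Real.pi) (α : Fin (N + 1) → ℝ) (g : ℝ) :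
    (∃ X Y : Matrix (Fin n₁ ⊕ (Fin n₂ ⊕ Fin N)) (Fin n₁ ⊕ (Fin n₂ ⊕ Fin N)) ℝ,
      X.IsSymm ∧ Y.PosDef ∧
        (-(gkypMatrix (augmented G₁ G₂ α) ω₁ ω₂ X Y g)).PosDef) ↔
      designGain G₁ G₂ ω₁ ω₂ α ^ 2 < g := by
  have hgr := designGain_isGreatest hG₁ hG₂ hω α
  have hn : ∀ ω : ℝ, 1 ≤ ‖Complex.exp (ω * Complex.I)‖ := fun ω => by
    rw [Complex.norm_exp_ofReal_mul_I]
  constructor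
  · rintro ⟨X, Y, hX, hY, h⟩
    obtain ⟨ω, hmem, hval⟩ := hgr.1
    obtain ⟨x, hx, -⟩ := exists_augmented_state hG₁ hG₂ α (hn ω)
    have := strict_bound_of_gkyp (by linarith) hX hY.posSemidef h hmem one_ne_zero hx
    rw [unit_form_eq, augmented_output_eq hG₁ hG₂ α (hn ω) hx, unit_form_eq,
      ← Complex.ofReal_mul, Complex.real_lt_real] at this
    simpa [← hval] using this
  · intro hlt
    -- Multipliers at the exact level `V²` leave a positive gap up to `g` for the perturbation.
    obtain ⟨X, Y, hX, hY, h⟩ := (lmi_iff hG₁ hG₂ hctrl hω₁ hω hω₂ α _).2 le_rfl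
    exact exists_strict_multipliers (augmented_isStable hG₁ hG₂ α) hX hY hlt h

/-- The generalized KYP matrix of the augmented realization is affine in `(X, Y, g, α)`. -/
theorem exists_affineMap_gkypMatrix (G₁ : StateSpace (Fin n₁)) (G₂ : StateSpace (Fin n₂))
    (ω₁ ω₂ : ℝ) :
    ∃ L : (Matrix (Fin n₁ ⊕ (Fin n₂ ⊕ Fin N)) (Fin n₁ ⊕ (Fin n₂ ⊕ Fin N)) ℝ ×
          Matrix (Fin n₁ ⊕ (Fin n₂ ⊕ Fin N)) (Fin n₁ ⊕ (Fin n₂ ⊕ Fin N)) ℝ ×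
          ℝ × (Fin (N + 1) → ℝ)) →ᵃ[ℝ]
        Matrix (((Fin n₁ ⊕ (Fin n₂ ⊕ Fin N)) ⊕ Unit) ⊕ Unit)
          (((Fin n₁ ⊕ (Fin n₂ ⊕ Fin N)) ⊕ Unit) ⊕ Unit) ℂ,
      ∀ X Y g α, L (X, Y, g, α) = gkypMatrix (augmented G₁ G₂ α) ω₁ ω₂ X Y g := by
  let f : (Matrix (Fin n₁ ⊕ (Fin n₂ ⊕ Fin N)) (Fin n₁ ⊕ (Fin n₂ ⊕ Fin N)) ℝ ×
      Matrix (Fin n₁ ⊕ (Fin n₂ ⊕ Fin N)) (Fin n₁ ⊕ (Fin n₂ ⊕ Fin N)) ℝ ×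
      ℝ × (Fin (N + 1) → ℝ)) → Matrix (((Fin n₁ ⊕ (Fin n₂ ⊕ Fin N)) ⊕ Unit) ⊕ Unit)
        (((Fin n₁ ⊕ (Fin n₂ ⊕ Fin N)) ⊕ Unit) ⊕ Unit) ℂ :=
    fun p => gkypMatrix (augmented G₁ G₂ p.2.2.2) ω₁ ω₂ p.1 p.2.1 p.2.2.1
  -- Affinity is linearity of `f - f 0`. No products of unknowns occur, because `A` and `B` do not
  -- depend on `α`.
  have hadd : ∀ p q, f (p + q) - f 0 = (f p - f 0) + (f q - f 0) := by
    rintro ⟨X, Y, g, α⟩ ⟨X', Y', g', α'⟩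
    ext ((i | i) | i) ((j | j) | j) <;>
      simp [f, gkypMatrix, gkypM1, gkypM2, gkypM3, augmented, Matrix.mul_add,
        Matrix.add_mul, cplx_add, cplx_smul, cplx_zero, add_smul]
    all_goals try ring1
    · rcases i with i | i | i <;> simp [cplx_apply, firC]
    · rcases j with j | j | j <;> simp [cplx_apply, firC]
  have hsmul : ∀ (c : ℝ) p, f (c • p) - f 0 = c • (f p - f 0) := by
    rintro c ⟨X, Y, g, α⟩
    ext ((i | i) | i) ((j | j) | j) <;>
      simp [f, gkypMatrix, gkypM1, gkypM2, gkypM3, augmented, cplx_smul, cplx_zero]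
    all_goals try ring1
    · rcases i with i | i | i <;> simp [cplx_apply, firC]
      ring
    · rcases j with j | j | j <;> simp [cplx_apply, firC]
      ring
  refine ⟨⟨f, ⟨⟨fun p => f p - f 0, hadd⟩, hsmul⟩, fun p v => ?_⟩, fun _ _ _ _ => rfl⟩
  have := hadd v p
  simp only [vadd_eq_add, LinearMap.coe_mk, AddHom.coe_mk]
  rw [sub_eq_iff_eq_add] at this
  rw [this]
  abel

end Design

theorem mainTheorem2 {n₁ n₂ N : ℕ}
    (G₁ : StateSpace (Fin n₁)) (G₂ : StateSpace (Fin n₂))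
    (hG₁ : G₁.IsStable) (hG₂ : G₂.IsStable)
    (hctrl : IsControllable (augA N G₁ G₂) (augB N G₁ G₂))
    (ω₁ ω₂ : ℝ) (hω₁ : 0 ≤ ω₁) (hω : ω₁ < ω₂) (hω₂ : ω₂ ≤ Real.pi) :
    -- the maximum defining the finite-frequency gain is attained
    (∀ α : Fin (N + 1) → ℝ,
      IsGreatest
        ((fun ω : ℝ =>
          ‖G₁.transfer (Complex.exp (ω * Complex.I))
            + firTransfer α (Complex.exp (ω * Complex.I))
              * G₂.transfer (Complex.exp (ω * Complex.I))‖) '' Set.Icc ω₁ ω₂)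
        (designGain G₁ G₂ ω₁ ω₂ α)) ∧
    -- the bound `≤ γ` is equivalent to the generalized KYP inequality
    (∀ (α : Fin (N + 1) → ℝ) (γ : ℝ), 0 ≤ γ →
      (designGain G₁ G₂ ω₁ ω₂ α ≤ γ ↔
        ∃ X Y : Matrix (Fin n₁ ⊕ (Fin n₂ ⊕ Fin N)) (Fin n₁ ⊕ (Fin n₂ ⊕ Fin N)) ℝ,
          X.IsSymm ∧ Y.PosSemidef ∧
            (-(gkypMatrix (augmented G₁ G₂ α) ω₁ ω₂ X Y (γ ^ 2))).PosSemidef)) ∧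
    -- the strict bound `< γ` is equivalent to the strict inequality with `Y ≻ 0`
    (∀ (α : Fin (N + 1) → ℝ) (γ : ℝ), 0 ≤ γ →
      (designGain G₁ G₂ ω₁ ω₂ α < γ ↔
        ∃ X Y : Matrix (Fin n₁ ⊕ (Fin n₂ ⊕ Fin N)) (Fin n₁ ⊕ (Fin n₂ ⊕ Fin N)) ℝ,
          X.IsSymm ∧ Y.PosDef ∧
            (-(gkypMatrix (augmented G₁ G₂ α) ω₁ ω₂ X Y (γ ^ 2))).PosDef)) ∧
    -- the generalized KYP matrix is affine in `(X, Y, γ², α)`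
    (∃ L : (Matrix (Fin n₁ ⊕ (Fin n₂ ⊕ Fin N)) (Fin n₁ ⊕ (Fin n₂ ⊕ Fin N)) ℝ ×
          Matrix (Fin n₁ ⊕ (Fin n₂ ⊕ Fin N)) (Fin n₁ ⊕ (Fin n₂ ⊕ Fin N)) ℝ ×
          ℝ × (Fin (N + 1) → ℝ)) →ᵃ[ℝ]
        Matrix (((Fin n₁ ⊕ (Fin n₂ ⊕ Fin N)) ⊕ Unit) ⊕ Unit)
          (((Fin n₁ ⊕ (Fin n₂ ⊕ Fin N)) ⊕ Unit) ⊕ Unit) ℂ,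
      ∀ X Y g α, L (X, Y, g, α) = gkypMatrix (augmented G₁ G₂ α) ω₁ ω₂ X Y g) ∧
    -- the min-max design problem is the semidefinite program "minimize `g = γ²`"
    (∀ (α : Fin (N + 1) → ℝ) (g : ℝ),
      ((∀ α' : Fin (N + 1) → ℝ, designGain G₁ G₂ ω₁ ω₂ α ≤ designGain G₁ G₂ ω₁ ω₂ α') ∧
          g = designGain G₁ G₂ ω₁ ω₂ α ^ 2) ↔
        ((∃ X Y, SDPFeasible G₁ G₂ ω₁ ω₂ X Y g α) ∧
          ∀ X' Y' g' α', SDPFeasible (N := N) G₁ G₂ ω₁ ω₂ X' Y' g' α' → g ≤ g')) := by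
  refine ⟨designGain_isGreatest hG₁ hG₂ hω, fun α γ hγ => ?_, fun α γ hγ => ?_,
    exists_affineMap_gkypMatrix G₁ G₂ ω₁ ω₂, fun α g => ⟨?_, ?_⟩⟩
  · rw [lmi_iff hG₁ hG₂ hctrl hω₁ hω hω₂,
      pow_le_pow_iff_left₀ (designGain_nonneg hG₁ hG₂ hω α) hγ two_ne_zero]
  · rw [strict_lmi_iff hG₁ hG₂ hctrl hω₁ hω hω₂,
      pow_lt_pow_iff_left₀ (designGain_nonneg hG₁ hG₂ hω α) hγ two_ne_zero]
  · rintro ⟨hmin, rfl⟩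
    refine ⟨(lmi_iff hG₁ hG₂ hctrl hω₁ hω hω₂ α _).2 le_rfl, fun X Y g α' hf => ?_⟩
    exact (pow_le_pow_left₀ (designGain_nonneg hG₁ hG₂ hω α) (hmin α') 2).trans
      ((lmi_iff hG₁ hG₂ hctrl hω₁ hω hω₂ α' g).1 ⟨X, Y, hf⟩)
  · rintro ⟨hfeas, hopt⟩
    have h1 := (lmi_iff hG₁ hG₂ hctrl hω₁ hω hω₂ α g).1 hfeas
    -- Every `α'` is feasible with its own level `V(α')²`, so an optimal `g` lies below all of
    -- these; with `g ≥ V(α)²` this gives both claims.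
    have h2 : ∀ α' : Fin (N + 1) → ℝ, g ≤ designGain G₁ G₂ ω₁ ω₂ α' ^ 2 := fun α' => by
      obtain ⟨X, Y, hf⟩ := (lmi_iff hG₁ hG₂ hctrl hω₁ hω hω₂ α' _).2 le_rfl
      exact hopt X Y _ α' hf
    refine ⟨fun α' => ?_, le_antisymm (h2 α) h1⟩
    exact (pow_le_pow_iff_left₀ (designGain_nonneg hG₁ hG₂ hω α)
      (designGain_nonneg hG₁ hG₂ hω α') two_ne_zero).1 (h1.trans (h2 α'))
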